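/- Let $A=[a_1,b_1]\times[a_2,b_2]$ with $a_1<b_1$ and $0\le a_2<b_2$, let $\beta_1>0$, $\beta_2>1$, $L>0$, $h_1<+\infty$, and let $\overline\beta=2\beta_1\beta_2/(\beta_1+\beta_2)$ be the harmonic mean of $\beta_1,\beta_2$. Let $Y$ be a positive random variable, $X$ a real covariate and $T$ a random observation time independent of $Y$ given $X$. Write $F(x,y)=P[Y\le y\mid X=x]$ for the conditional c.d.f. of $Y$ given $X$. One observes an i.i.d. sample $(X_i,T_i,\delta_i)_{i=1,\dots,n}$ of copies of $(X,T,\delta)$ with $\delta=\mathbf 1_{\{Y\le T\}}$ (current status data). Assume that $(X,T)$ has a density $f_{(X,T)}$ with respect to Lebesgue measure and that $f_{(X,T)}\le h_1$ almost everywhere on $A$ (in particular this holds if $\|f_{(X,T)}\|_\infty\le h_1$). Let $\mathcal B^{\beta}_{2,\infty}(A,L)$ be the set of the $f\in L^2(A)$ with $$\sup_{t>0}\Big[t^{-\beta_1}\omega_{r_1,1}(f,t)+t^{-\beta_2}\omega_{r_2,2}(f,t)\Big]+\|f\|_{L^2(A)}\le L,\qquad r_j=\lfloor\beta_j\rfloor+1,$$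 where $\omega_{r,j}(f,t)=\sup_{|h|\le t}\big\|\sum_{k=0}^r\binom rk(-1)^{r-k}f(\cdot+khe_j)\big\|_{L^2(A^r_{h,j})}$, $A^r_{h,j}=\{p\in A: p+rhe_j\in A\}$, and $(e_1,e_2)$ is the canonical basis of $\mathbb R^2$. Then there is a constant $c>0$ depending only on $A$, $\beta_1$, $\beta_2$, $L$ and $h_1$ such that, for every such density $f_{(X,T)}$ and every $n\ge1$, $$\inf_{\widehat F_n}\ \sup_{F\in\mathcal B^{\beta}_{2,\infty}(A,L)}\mathbb E\big[\|\widehat F_n-F\|_{L^2(A)}^2\big]\ \ge\ c\,n^{-\overline\beta/(\overline\beta+1)},$$ where the supremum is over the conditional c.d.f.'s $F$ of a positive random variable given $X$ whose restriction to $A$ belongs to $\mathcal B^{\beta}_{2,\infty}(A,L)$, and the infimum is over all estimators $\widehat F_n$ based on the sample $(X_i,T_i,\delta_i)_{i=1,\dots,n}$. -/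

import Mathlib

open MeasureTheory ProbabilityTheory
open scoped ENNReal NNReal

namespace CurrentStatus

/-! ### Anisotropic Besov balls on a compact rectangle -/

/-- The rectangle `A = [a₁, b₁] × [a₂, b₂]`. -/
def rect (a₁ b₁ a₂ b₂ : ℝ) : Set (ℝ × ℝ) := Set.Icc a₁ b₁ ×ˢ Set.Icc a₂ b₂

/-- The directional difference operator of order `r` and step `h` in the direction `e`:
`∑ₖ (r choose k) (-1)^(r-k) f (p + k h e)`. -/
def dirDiff (r : ℕ) (h : ℝ) (e : ℝ × ℝ) (f : ℝ × ℝ → ℝ) (p : ℝ × ℝ) : ℝ :=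
  ∑ k ∈ Finset.range (r + 1), (r.choose k : ℝ) * (-1) ^ (r - k) * f (p + ((k : ℝ) * h) • e)

/-- The set of the points `p ∈ A` such that `p + r h e ∈ A`. -/
def diffDomain (A : Set (ℝ × ℝ)) (r : ℕ) (h : ℝ) (e : ℝ × ℝ) : Set (ℝ × ℝ) :=
  {p | p ∈ A ∧ p + ((r : ℝ) * h) • e ∈ A}

/-- The directional `L²`-modulus of smoothness of order `r` in the direction `e`. -/
noncomputable def modulus (A : Set (ℝ × ℝ)) (r : ℕ) (e : ℝ × ℝ) (f : ℝ × ℝ → ℝ) (t : ℝ) : ℝ≥0∞ :=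
  ⨆ (h : ℝ) (_ : |h| ≤ t), eLpNorm (dirDiff r h e f) 2 (volume.restrict (diffDomain A r h e))

/-- The anisotropic Besov seminorm with parameters `((β₁, β₂), 2, ∞)`; the order of the
differences in direction `j` is `⌊βⱼ⌋ + 1`. -/
noncomputable def besovSeminorm (A : Set (ℝ × ℝ)) (β₁ β₂ : ℝ) (f : ℝ × ℝ → ℝ) : ℝ≥0∞ :=
  ⨆ (t : ℝ) (_ : 0 < t),
    (ENNReal.ofReal (t ^ (-β₁)) * modulus A (⌊β₁⌋₊ + 1) (1, 0) f t +
      ENNReal.ofReal (t ^ (-β₂)) * modulus A (⌊β₂⌋₊ + 1) (0, 1) f t)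

/-- The anisotropic Besov norm. -/
noncomputable def besovNorm (A : Set (ℝ × ℝ)) (β₁ β₂ : ℝ) (f : ℝ × ℝ → ℝ) : ℝ≥0∞ :=
  besovSeminorm A β₁ β₂ f + eLpNorm f 2 (volume.restrict A)

/-- The anisotropic Besov ball of radius `L`. Membership depends on `f` only through its
restriction to `A` (for a rectangle `A`). -/
def besovBall (A : Set (ℝ × ℝ)) (β₁ β₂ L : ℝ) : Set (ℝ × ℝ → ℝ) :=
  {f | MemLp f 2 (volume.restrict A) ∧ besovNorm A β₁ β₂ f ≤ ENNReal.ofReal L}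

/-! ### The current status model

The conditional distribution of the lifetime `Y` given the covariate `X` is a Markov kernel `κ`;
the distribution of the pair `(X, T)` is a measure `ν` on the plane. -/

/-- The conditional c.d.f. `F (x, y) = P (Y ≤ y | X = x)`. -/
noncomputable def condCdf (κ : Kernel ℝ ℝ) (p : ℝ × ℝ) : ℝ := cdf (κ p.1) p.2

/-- One observation `(X, T, δ)`. -/
abbrev Obs : Type := ℝ × ℝ × Bool

/-- The map `((x, t), y) ↦ (x, t, 1_{y ≤ t})`. -/
noncomputable def observe (q : (ℝ × ℝ) × ℝ) : Obs := (q.1.1, q.1.2, decide (q.2 ≤ q.1.2))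

theorem measurable_observe : Measurable observe := by
  unfold observe
  refine (measurable_fst.comp measurable_fst).prodMk
    ((measurable_snd.comp measurable_fst).prodMk ?_)
  refine measurable_to_bool ?_
  have h : (fun q : (ℝ × ℝ) × ℝ => decide (q.2 ≤ q.1.2)) ⁻¹' {true} = {q | q.2 ≤ q.1.2} := by
    ext q; simp
  rw [h]
  exact measurableSet_le measurable_snd (measurable_snd.comp measurable_fst)

/-- The joint distribution of `((X, T), Y)`: `(X, T)` has distribution `ν` and, given `(X, T)`,
`Y` has distribution `κ X`, that is, `Y` and `T` are independent given `X`. -/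
noncomputable def fullLaw (ν : Measure (ℝ × ℝ)) (κ : Kernel ℝ ℝ) : Measure ((ℝ × ℝ) × ℝ) :=
  ν ⊗ₘ (κ.comap Prod.fst measurable_fst)

/-- The distribution of one observation `(X, T, δ)`. -/
noncomputable def obsLaw (ν : Measure (ℝ × ℝ)) (κ : Kernel ℝ ℝ) : Measure Obs :=
  (fullLaw ν κ).map observe

instance (ν : Measure (ℝ × ℝ)) [IsProbabilityMeasure ν] (κ : Kernel ℝ ℝ) [IsMarkovKernel κ] :
    IsProbabilityMeasure (obsLaw ν κ) := by
  unfold obsLaw fullLaw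
  exact Measure.isProbabilityMeasure_map measurable_observe.aemeasurable

/-- The distribution of the i.i.d. sample `(Xᵢ, Tᵢ, δᵢ)`, `i = 1, …, n`. -/
noncomputable def sampleLaw (n : ℕ) (ν : Measure (ℝ × ℝ)) (κ : Kernel ℝ ℝ) :
    Measure (Fin n → Obs) :=
  Measure.pi fun _ => obsLaw ν κ

/-- The conditional distributions of a positive lifetime whose conditional c.d.f. belongs, on `A`,
to the anisotropic Besov ball of radius `L`. -/
def lifetimeClass (A : Set (ℝ × ℝ)) (β₁ β₂ L : ℝ) : Set (Kernel ℝ ℝ) :=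
  {κ | IsMarkovKernel κ ∧ (∀ x, κ x (Set.Iic 0) = 0) ∧ condCdf κ ∈ besovBall A β₁ β₂ L}

/-- Estimators based on a sample of size `n`: measurable functions of the sample and of the point
of the plane. -/
def estimators (n : ℕ) : Set ((Fin n → Obs) → ℝ × ℝ → ℝ) :=
  {G | Measurable (Function.uncurry G)}

/-- The `L²`-risk `E ‖G - F‖²`, with the norm of `L²(A)`. -/
noncomputable def risk (A : Set (ℝ × ℝ)) (n : ℕ) (ν : Measure (ℝ × ℝ))
    (G : (Fin n → Obs) → ℝ × ℝ → ℝ) (κ : Kernel ℝ ℝ) : ℝ≥0∞ :=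
  ∫⁻ s, (eLpNorm (fun p => G s p - condCdf κ p) 2 (volume.restrict A)) ^ 2 ∂(sampleLaw n ν κ)

/-- The minimax `L²`-risk: infimum over all estimators of the supremum of the risk. -/
noncomputable def minimaxRisk (A : Set (ℝ × ℝ)) (β₁ β₂ L : ℝ) (n : ℕ) (ν : Measure (ℝ × ℝ)) :
    ℝ≥0∞ :=
  ⨅ G ∈ estimators n, ⨆ κ ∈ lifetimeClass A β₁ β₂ L, risk A n ν G κ

/-- The harmonic mean of `β₁` and `β₂`. -/
noncomputable def harmMean (β₁ β₂ : ℝ) : ℝ := 2 * β₁ * β₂ / (β₁ + β₂)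

end CurrentStatus

namespace CurrentStatus

/-! ### Likelihood ratios of product measures and the hypercube argument -/

section Testing

variable {X : Type*} [MeasurableSpace X] {n : ℕ}

/-! The bound is Assouad's hypercube argument with a chi-square control of neighbouring vertices.
Fix `c` in `(a₂, b₂)` and cut `[a₁, b₁] × [c, b₂]` into `m₁ × m₂` cells of sides `w₁`, `w₂`. For `0
≤ y ≤ b₂` take `F_θ(x, y) = ε y + γ ∑ θ_jk ψ((x - a₁)/w₁ - j) ψ((y - c)/w₂ - k)`, with `ψ` a smooth
bump on `(0, 1)`; an atom above `b₂` carries the remaining mass. The slope `ε` keeps `F_θ`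
increasing in `y`, and on the cells `ε c ≤ F_θ ≤ 1/2`.

Given `(X, T)`, the observation `δ` is Bernoulli with parameter `F(X, T)`. Flipping one bit
therefore costs a chi-square divergence of at most `2γ²/(εc) · h₁ w₁ w₂` per observation
(`lintegral_likelihoodRatio_sq_le`). If `n` times this is at most `1/2`, the bit cannot be tested
reliably (`two_point_bound`), so each cell contributes loss of order `γ² w₁ w₂`; averaging over the
cube (`hypercube_bound`) gives total risk of order `γ²`.

Membership in the Besov ball requires `γ ≲ wⱼ ^ βⱼ`. With `γ = c₀ h` and `wⱼ` of order `h ^ (1/βⱼ)`,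
the information constraint becomes `n h ^ (2 + 1/β₁ + 1/β₂) ≲ 1`, and the resulting `h²` is the
stated rate. The condition `β₂ > 1` enters twice: `γ / w₂` stays bounded, so monotonicity survives,
and differences of order `⌊β₂⌋ + 1 ≥ 2` annihilate `ε y`. -/

theorem lintegral_pi_prod (P : Measure X) [IsProbabilityMeasure P] {f : X → ℝ≥0∞}
    (hf : Measurable f) :
    ∫⁻ s, ∏ i, f (s i) ∂(Measure.pi fun _ : Fin n => P) = (∫⁻ x, f x ∂P) ^ n := by
  have hind : iIndepFun (fun (i : Fin n) (s : Fin n → X) => f (s i))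
      (Measure.pi fun _ : Fin n => P) := iIndepFun_pi fun _ => hf.aemeasurable
  rw [lintegral_prod_eq_prod_lintegral_of_indepFun Finset.univ _ hind
    fun i => hf.comp (measurable_pi_apply i)]
  have h (i : Fin n) : ∫⁻ s, f (s i) ∂(Measure.pi fun _ : Fin n => P) = ∫⁻ x, f x ∂P :=
    (measurePreserving_eval (fun _ : Fin n => P) i).lintegral_comp hf
  simp [h]

theorem pi_withDensity (P : Measure X) [IsProbabilityMeasure P] {l : X → ℝ≥0∞}
    (hl : Measurable l) [IsProbabilityMeasure (P.withDensity l)] :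
    (Measure.pi fun _ : Fin n => P.withDensity l) =
      (Measure.pi fun _ : Fin n => P).withDensity fun s => ∏ i, l (s i) := by
  have (_ : Fin n) : SigmaFinite (P.withDensity l) := inferInstance
  refine Measure.pi_eq (μ := fun _ : Fin n => P.withDensity l) fun s hs => ?_
  have hind : iIndepFun (fun (i : Fin n) (t : Fin n → X) => (s i).indicator l (t i))
      (Measure.pi fun _ : Fin n => P) :=
    iIndepFun_pi fun i => (hl.indicator (hs i)).aemeasurable
  rw [withDensity_apply _ (MeasurableSet.univ_pi hs),
    ← lintegral_indicator (MeasurableSet.univ_pi hs)]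
  have h1 (t : Fin n → X) : (Set.univ.pi s).indicator (fun t => ∏ i, l (t i)) t =
      ∏ i, (s i).indicator l (t i) := by
    by_cases ht : t ∈ Set.univ.pi s
    · rw [Set.indicator_of_mem ht]
      exact Finset.prod_congr rfl fun i _ =>
        (Set.indicator_of_mem (ht i (Set.mem_univ i)) l).symm
    · rw [Set.indicator_of_notMem ht]
      simp only [Set.mem_univ_pi, not_forall] at ht
      obtain ⟨i, hi⟩ := ht
      exact (Finset.prod_eq_zero (Finset.mem_univ i) (Set.indicator_of_notMem hi l)).symm
  simp_rw [h1]
  rw [lintegral_prod_eq_prod_lintegral_of_indepFun Finset.univ _ hind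
    fun i => (hl.indicator (hs i)).comp (measurable_pi_apply i)]
  refine Finset.prod_congr rfl fun i _ => ?_
  rw [withDensity_apply _ (hs i), ← lintegral_indicator (hs i)]
  exact (measurePreserving_eval (fun _ : Fin n => P) i).lintegral_comp (hl.indicator (hs i))

theorem le_one_add_sq_div_four (x : ℝ≥0∞) : x ≤ 1 + x ^ 2 / 4 := by
  induction x with
  | top => simp [ENNReal.top_div]
  | coe x =>
    have h : x ≤ 1 + x ^ 2 / 4 := by
      rw [← NNReal.coe_le_coe]
      push_cast
      nlinarith [sq_nonneg ((x : ℝ) / 2 - 1)]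
    calc (x : ℝ≥0∞) ≤ ((1 + x ^ 2 / 4 : ℝ≥0) : ℝ≥0∞) := by exact_mod_cast h
      _ = _ := by rw [ENNReal.coe_add, ENNReal.coe_div (by norm_num)]; norm_cast

/-- A two-point bound: if the likelihood ratio of `n` observations has second moment at most `2`,
then the sum of two losses that add up to `d` has expected value at least `d / 2`. -/
theorem two_point_bound (P : Measure X) [IsProbabilityMeasure P] {l : X → ℝ≥0∞}
    (hl : Measurable l) [hQ : IsProbabilityMeasure (P.withDensity l)]
    (h2 : (∫⁻ x, l x ^ 2 ∂P) ^ n ≤ 2) {a b : (Fin n → X) → ℝ≥0∞} (ha : Measurable a)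
    (hb : Measurable b) {d : ℝ≥0∞} (hd : d ≠ ⊤) (hab : ∀ s, d ≤ a s + b s) :
    d / 2 ≤ ∫⁻ s, a s ∂(Measure.pi fun _ : Fin n => P) +
      ∫⁻ s, b s ∂(Measure.pi fun _ : Fin n => P.withDensity l) := by
  set M := Measure.pi fun _ : Fin n => P with hM
  set Λ : (Fin n → X) → ℝ≥0∞ := fun s => ∏ i, l (s i) with hΛ
  have hΛm : Measurable Λ := by
    rw [hΛ]; fun_prop
  have hone : ∫⁻ x, l x ∂P = 1 := by
    have := hQ.measure_univ
    rwa [withDensity_apply _ MeasurableSet.univ, Measure.restrict_univ] at this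
  have hΛ1 : ∫⁻ s, Λ s ∂M = 1 := by
    rw [hM, hΛ, lintegral_pi_prod P hl, hone, one_pow]
  have hΛ2 : ∫⁻ s, Λ s ^ 2 ∂M ≤ 2 := by
    have : ∀ s, Λ s ^ 2 = ∏ i, (fun x => l x ^ 2) (s i) := fun s => by
      simp only [hΛ, Finset.prod_pow]
    simp_rw [this]
    rw [hM, lintegral_pi_prod P (hl.pow_const 2)]
    exact h2
  -- Where `Λ ≤ 1`, `(a + b) Λ ≤ a + Λ b`; where `Λ ≥ 1`, `Λ ≤ 1 + Λ² / 4` and `a + b ≤ a + Λ b`.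
  -- Integrating, the quadratic term costs at most `d / 2`, which is then cancelled.
  have hpt (s : Fin n → X) : d * Λ s ≤ (a s + Λ s * b s) + d / 4 * Λ s ^ 2 := by
    rcases le_total (Λ s) 1 with h | h
    · calc d * Λ s ≤ (a s + b s) * Λ s := by gcongr; exact hab s
        _ = a s * Λ s + Λ s * b s := by ring
        _ ≤ a s * 1 + Λ s * b s := by gcongr
        _ = a s + Λ s * b s := by rw [mul_one]
        _ ≤ _ := le_self_add
    · calc d * Λ s ≤ d * (1 + Λ s ^ 2 / 4) := by gcongr; exact le_one_add_sq_div_four _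
        _ = d + d / 4 * Λ s ^ 2 := by simp only [div_eq_mul_inv]; ring
        _ ≤ (a s + 1 * b s) + d / 4 * Λ s ^ 2 := by rw [one_mul]; gcongr; exact hab s
        _ ≤ _ := by gcongr
  have hint := lintegral_mono (μ := M) hpt
  rw [lintegral_const_mul _ hΛm, hΛ1, mul_one,
    lintegral_add_right _ ((hΛm.pow_const 2).const_mul _),
    lintegral_add_left ha, lintegral_const_mul _ (hΛm.pow_const 2)] at hint
  have hbQ : ∫⁻ s, b s ∂(Measure.pi fun _ : Fin n => P.withDensity l) =
      ∫⁻ s, Λ s * b s ∂M := by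
    rw [pi_withDensity P hl]
    exact lintegral_withDensity_eq_lintegral_mul _ hΛm hb
  rw [hbQ]
  have h3 : d ≤ (∫⁻ s, a s ∂M + ∫⁻ s, Λ s * b s ∂M) + d / 2 := by
    refine hint.trans ?_
    gcongr
    calc d / 4 * ∫⁻ s, Λ s ^ 2 ∂M ≤ d / 4 * 2 := by gcongr
      _ = d / 2 := by
        rw [div_eq_mul_inv, div_eq_mul_inv, mul_assoc]
        congr 1
        rw [show (4 : ℝ≥0∞) = 2 * 2 by norm_num, ENNReal.mul_inv (by simp) (by simp), mul_assoc,
          ENNReal.inv_mul_cancel (by simp) (by simp), mul_one]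
  have h4 : d / 2 + d / 2 ≤ (∫⁻ s, a s ∂M + ∫⁻ s, Λ s * b s ∂M) + d / 2 := by
    rwa [ENNReal.add_halves]
  exact (ENNReal.add_le_add_iff_right (ENNReal.div_ne_top hd (by simp))).1 h4

end Testing

section Hypercube

variable {ι : Type*} [DecidableEq ι]

/-- The vertex of the hypercube obtained from `θ` by changing the coordinate `c`. -/
def flipAt (c : ι) (θ : ι → Bool) : ι → Bool := Function.update θ c (!θ c)

theorem flipAt_involutive (c : ι) : Function.Involutive (flipAt c) := fun θ => by
  simp [flipAt]

/-- Assouad's averaging argument. -/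
theorem hypercube_bound [Fintype ι] (R : (ι → Bool) → ι → ℝ≥0∞) (d S : ℝ≥0∞)
    (hR : ∀ θ c, d ≤ R θ c + R (flipAt c θ) c) (hS : ∀ θ, ∑ c, R θ c ≤ S) :
    Fintype.card ι * d / 2 ≤ S := by
  set K : ℝ≥0∞ := ((Fintype.card (ι → Bool) : ℕ) : ℝ≥0∞) with hK
  have hK0 : K ≠ 0 := by simp [hK]
  have hKt : K ≠ ⊤ := by simp [hK]
  have h1 : K * (Fintype.card ι * d) ≤ K * (2 * S) := by
    calc K * (Fintype.card ι * d) = ∑ c : ι, ∑ _θ : ι → Bool, d := by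
          simp only [Finset.sum_const, Finset.card_univ, nsmul_eq_mul, hK]; ring
      _ ≤ ∑ c : ι, ∑ θ, (R θ c + R (flipAt c θ) c) := by gcongr; exact hR _ _
      _ = ∑ c : ι, (∑ θ, R θ c + ∑ θ, R θ c) := by
          refine Finset.sum_congr rfl fun c _ => ?_
          rw [Finset.sum_add_distrib]
          congr 1
          -- Flipping a bit permutes the vertices, so both risks have the same sum over the cube.
          exact Equiv.sum_comp (flipAt_involutive c).toPerm fun θ => R θ c
      _ = 2 * ∑ θ, ∑ c : ι, R θ c := by
          rw [Finset.sum_add_distrib, ← two_mul, Finset.sum_comm]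
      _ ≤ 2 * ∑ _θ : ι → Bool, S := by gcongr; exact hS _
      _ = K * (2 * S) := by
          simp only [Finset.sum_const, Finset.card_univ, nsmul_eq_mul, hK]; ring
  have h2 : Fintype.card ι * d ≤ 2 * S := (ENNReal.mul_le_mul_iff_right hK0 hKt).1 h1
  exact ENNReal.div_le_of_le_mul (by rwa [mul_comm S])

end Hypercube

/-! ### The law of one observation -/

section Observation

variable {ν : Measure (ℝ × ℝ)} {κ κ' : Kernel ℝ ℝ}

theorem condCdf_eq_real [IsMarkovKernel κ] (p : ℝ × ℝ) :
    condCdf κ p = (κ p.1).real (Set.Iic p.2) := cdf_eq_real _ _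

theorem condCdf_nonneg (p : ℝ × ℝ) : 0 ≤ condCdf κ p := cdf_nonneg _ _

theorem condCdf_le_one (p : ℝ × ℝ) : condCdf κ p ≤ 1 := cdf_le_one _ _

theorem measurable_condCdf [IsMarkovKernel κ] : Measurable (condCdf κ) := by
  have hs : MeasurableSet {q : (ℝ × ℝ) × ℝ | q.2 ≤ q.1.2} :=
    measurableSet_le measurable_snd (measurable_snd.comp measurable_fst)
  have h := Kernel.measurable_kernel_prodMk_left (κ := κ.comap Prod.fst measurable_fst) hs
  have h2 : condCdf κ = fun p => _ := funext fun p => condCdf_eq_real p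
  rw [h2]
  exact h.ennreal_toReal

/-- Given `(X, T)`, the observation depends on `Y` only through the event `Y ≤ T`, so the inner
integral splits into two constants. -/
theorem lintegral_obsLaw [IsProbabilityMeasure ν] [IsMarkovKernel κ] {g : Obs → ℝ≥0∞}
    (hg : Measurable g) :
    ∫⁻ o, g o ∂(obsLaw ν κ) = ∫⁻ p, (ENNReal.ofReal (condCdf κ p) * g (p.1, p.2, true) +
      ENNReal.ofReal (1 - condCdf κ p) * g (p.1, p.2, false)) ∂ν := by
  rw [obsLaw, lintegral_map hg measurable_observe, fullLaw,
    Measure.lintegral_compProd (f := fun q => g (observe q)) (hg.comp measurable_observe)]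
  refine lintegral_congr fun p => ?_
  have hI : MeasurableSet (Set.Iic p.2) := measurableSet_Iic
  rw [Kernel.comap_apply, ← lintegral_add_compl _ hI]
  congr 1
  · rw [setLIntegral_congr_fun (g := fun _ => g (p.1, p.2, true)) hI, setLIntegral_const,
      condCdf_eq_real, ofReal_measureReal, mul_comm]
    intro y hy
    have : y ≤ p.2 := hy
    simp [observe, this]
  · rw [setLIntegral_congr_fun (g := fun _ => g (p.1, p.2, false)) hI.compl, setLIntegral_const,
      condCdf_eq_real, ← probReal_compl_eq_one_sub hI, ofReal_measureReal, mul_comm]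
    intro y hy
    have : ¬ y ≤ p.2 := hy
    simp [observe, this]

/-- The likelihood ratio of one observation between two conditional distributions. -/
noncomputable def likelihoodRatio (κ κ' : Kernel ℝ ℝ) (o : Obs) : ℝ≥0∞ :=
  bif o.2.2 then ENNReal.ofReal (condCdf κ' (o.1, o.2.1) / condCdf κ (o.1, o.2.1))
  else ENNReal.ofReal ((1 - condCdf κ' (o.1, o.2.1)) / (1 - condCdf κ (o.1, o.2.1)))

theorem measurable_likelihoodRatio [IsMarkovKernel κ] [IsMarkovKernel κ'] :
    Measurable (likelihoodRatio κ κ') := by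
  have hp : Measurable fun o : Obs => (o.1, o.2.1) := by fun_prop
  have h1 := (measurable_condCdf (κ := κ)).comp hp
  have h2 := (measurable_condCdf (κ := κ')).comp hp
  have hs : MeasurableSet {o : Obs | o.2.2 = true} :=
    (measurable_snd.comp measurable_snd) (measurableSet_singleton true)
  have h3 : likelihoodRatio κ κ' = fun o : Obs => if o ∈ {o : Obs | o.2.2 = true} then
      ENNReal.ofReal (condCdf κ' (o.1, o.2.1) / condCdf κ (o.1, o.2.1))
      else ENNReal.ofReal ((1 - condCdf κ' (o.1, o.2.1)) / (1 - condCdf κ (o.1, o.2.1))) := by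
    ext o
    obtain ⟨x, t, b⟩ := o
    cases b <;> simp [likelihoodRatio]
  classical
  rw [h3]
  refine Measurable.ite hs ?_ ?_
  · exact (h2.div h1).ennreal_ofReal
  · exact ((measurable_const.sub h2).div (measurable_const.sub h1)).ennreal_ofReal

/-- The hypotheses at `0` and `1` are absolute continuity of the Bernoulli laws; they make the
convention `x / 0 = 0` harmless. -/
theorem obsLaw_eq_withDensity [IsProbabilityMeasure ν] [IsMarkovKernel κ] [IsMarkovKernel κ']
    (h0 : ∀ p, condCdf κ p = 0 → condCdf κ' p = 0) (h1 : ∀ p, condCdf κ p = 1 → condCdf κ' p = 1) :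
    obsLaw ν κ' = (obsLaw ν κ).withDensity (likelihoodRatio κ κ') := by
  ext s hs
  have hm := measurable_likelihoodRatio (κ := κ) (κ' := κ')
  rw [withDensity_apply _ hs, ← lintegral_indicator hs, lintegral_obsLaw (hm.indicator hs),
    ← lintegral_indicator_one hs, lintegral_obsLaw (measurable_one.indicator hs)]
  refine lintegral_congr fun p => ?_
  have e1 : ENNReal.ofReal (condCdf κ p) * likelihoodRatio κ κ' (p.1, p.2, true) =
      ENNReal.ofReal (condCdf κ' p) := by
    simp only [likelihoodRatio, cond_true]
    rw [← ENNReal.ofReal_mul (condCdf_nonneg _)]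
    by_cases h : condCdf κ p = 0
    · rw [h, h0 p h]; simp
    · rw [mul_div_cancel₀ _ h]
  have e2 : ENNReal.ofReal (1 - condCdf κ p) * likelihoodRatio κ κ' (p.1, p.2, false) =
      ENNReal.ofReal (1 - condCdf κ' p) := by
    simp only [likelihoodRatio, cond_false]
    rw [← ENNReal.ofReal_mul (sub_nonneg.2 (condCdf_le_one _))]
    by_cases h : condCdf κ p = 1
    · rw [h, h1 p h]; simp
    · rw [mul_div_cancel₀ _ (sub_ne_zero.2 (Ne.symm h))]
  congr 1
  · by_cases h : (p.1, p.2, true) ∈ s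
    · simp only [Set.indicator_of_mem h, Pi.one_apply, mul_one]; exact e1.symm
    · simp only [Set.indicator_of_notMem h, mul_zero]
  · by_cases h : (p.1, p.2, false) ∈ s
    · simp only [Set.indicator_of_mem h, Pi.one_apply, mul_one]; exact e2.symm
    · simp only [Set.indicator_of_notMem h, mul_zero]

/-- A bound on the second moment of the likelihood ratio of two conditional distributions whose
distribution functions differ by at most `γ` on `C` and agree elsewhere. -/
theorem lintegral_likelihoodRatio_sq_le [IsProbabilityMeasure ν] [IsMarkovKernel κ]
    [IsMarkovKernel κ'] {C : Set (ℝ × ℝ)} (hC : MeasurableSet C) {η γ : ℝ} (hη : 0 < η)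
    (hout : ∀ p ∉ C, condCdf κ' p = condCdf κ p)
    (hin : ∀ p ∈ C, η ≤ condCdf κ p ∧ condCdf κ p ≤ 1 / 2 ∧ |condCdf κ' p - condCdf κ p| ≤ γ) :
    ∫⁻ o, likelihoodRatio κ κ' o ^ 2 ∂(obsLaw ν κ) ≤
      1 + ENNReal.ofReal (2 * γ ^ 2 / η) * ν C := by
  rw [lintegral_obsLaw (measurable_likelihoodRatio.pow_const 2)]
  have hpt (p : ℝ × ℝ) : ENNReal.ofReal (condCdf κ p) * likelihoodRatio κ κ' (p.1, p.2, true) ^ 2 +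
      ENNReal.ofReal (1 - condCdf κ p) * likelihoodRatio κ κ' (p.1, p.2, false) ^ 2 ≤
      1 + C.indicator (fun _ => ENNReal.ofReal (2 * γ ^ 2 / η)) p := by
    simp only [likelihoodRatio, cond_true, cond_false]
    have hF0 := condCdf_nonneg (κ := κ) p
    have hF1 := condCdf_le_one (κ := κ) p
    have hG0 := condCdf_nonneg (κ := κ') p
    have hG1 := condCdf_le_one (κ := κ') p
    rw [← ENNReal.ofReal_pow (by positivity), ← ENNReal.ofReal_pow
      (div_nonneg (sub_nonneg.2 hG1) (sub_nonneg.2 hF1)), ← ENNReal.ofReal_mul hF0,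
      ← ENNReal.ofReal_mul (sub_nonneg.2 hF1), ← ENNReal.ofReal_add (by positivity)
      (mul_nonneg (sub_nonneg.2 hF1) (sq_nonneg _))]
    by_cases hp : p ∈ C
    · obtain ⟨h1, h2, h3⟩ := hin p hp
      rw [Set.indicator_of_mem hp, ← ENNReal.ofReal_one, ← ENNReal.ofReal_add zero_le_one
        (by positivity)]
      apply ENNReal.ofReal_le_ofReal
      set F := condCdf κ p
      set G := condCdf κ' p
      have hFp : 0 < F := hη.trans_le h1
      have hFq : 0 < 1 - F := by linarith
      -- The chi-square identity for two Bernoulli laws.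
      have hkey : F * (G / F) ^ 2 + (1 - F) * ((1 - G) / (1 - F)) ^ 2 =
          1 + (G - F) ^ 2 / (F * (1 - F)) := by
        field_simp
        ring
      rw [hkey]
      have hsq : (G - F) ^ 2 ≤ γ ^ 2 := sq_le_sq' (by linarith [abs_le.1 h3 |>.1])
        (abs_le.1 h3).2
      have hden : η / 2 ≤ F * (1 - F) := by nlinarith
      have : (G - F) ^ 2 / (F * (1 - F)) ≤ γ ^ 2 / (η / 2) := by gcongr
      have h4 : γ ^ 2 / (η / 2) = 2 * γ ^ 2 / η := by field_simp
      linarith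
    · rw [Set.indicator_of_notMem hp, add_zero, hout p hp, ← ENNReal.ofReal_one]
      apply ENNReal.ofReal_le_ofReal
      set F := condCdf κ p
      have e1 : F * (F / F) ^ 2 = F := by
        by_cases h : F = 0
        · simp [h]
        · rw [div_self h]; ring
      have e2 : (1 - F) * ((1 - F) / (1 - F)) ^ 2 = 1 - F := by
        by_cases h : 1 - F = 0
        · simp [h]
        · rw [div_self h]; ring
      rw [e1, e2]
      linarith
  refine (lintegral_mono hpt).trans ?_
  rw [lintegral_add_left measurable_const, lintegral_indicator hC, setLIntegral_const]
  simp

end Observation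

/-! ### Finite differences of smooth functions -/

section Differences

/-- Peel off one difference: by the mean value inequality, `fwdDiff s f` has `r`-th derivative at
most `|s| * M` when the `(r + 1)`-th derivative of `f` is at most `M`. -/
theorem abs_fwdDiff_iter_le_of_iteratedDeriv (r : ℕ) {f : ℝ → ℝ} (hf : ContDiff ℝ r f) {M : ℝ}
    (hM : ∀ x, |iteratedDeriv r f x| ≤ M) (s x : ℝ) : |(fwdDiff s)^[r] f x| ≤ |s| ^ r * M := by
  induction r generalizing f M with
  | zero => simpa using hM x
  | succ r ih =>
    rw [Function.iterate_succ_apply, pow_succ, mul_assoc]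
    have hfr : ContDiff ℝ r f := hf.of_le (by exact_mod_cast Nat.le_succ r)
    have hs : ContDiff ℝ r fun y => f (y + s) := hfr.comp (contDiff_id.add contDiff_const)
    refine ih (hs.sub hfr) fun y => ?_
    have h1 : iteratedDeriv r (fwdDiff s f) y =
        iteratedDeriv r f (y + s) - iteratedDeriv r f y := by
      have h2 : fwdDiff s f = (fun y => f (y + s)) - f := rfl
      rw [h2, iteratedDeriv_sub hs.contDiffAt hfr.contDiffAt, iteratedDeriv_comp_add_const]
    refine (congrArg abs h1).trans_le ?_
    have hd : Differentiable ℝ (iteratedDeriv r f) := hf.differentiable_iteratedDeriv' r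
    have h3 := Convex.norm_image_sub_le_of_norm_deriv_le (f := iteratedDeriv r f) (C := M)
      (s := Set.univ) (x := y) (y := y + s) (fun z _ => hd z)
      (fun z _ => by rw [← iteratedDeriv_succ]; exact hM z) convex_univ trivial trivial
    rw [add_sub_cancel_left, Real.norm_eq_abs, Real.norm_eq_abs] at h3
    linarith

theorem abs_fwdDiff_iter_le_of_bound (r : ℕ) {f : ℝ → ℝ} {B : ℝ} (hB : ∀ x, |f x| ≤ B)
    (s x : ℝ) : |(fwdDiff s)^[r] f x| ≤ 2 ^ r * B := by
  induction r generalizing f B with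
  | zero => simpa using hB x
  | succ r ih =>
    rw [Function.iterate_succ_apply, pow_succ, mul_assoc]
    refine ih fun y => ?_
    have h := abs_sub (f (y + s)) (f y)
    change |f (y + s) - f y| ≤ _
    linarith [hB (y + s), hB y]

/-- Small steps use the derivative bound and `|s| ^ r ≤ |s| ^ β`; large steps use the trivial bound
and `1 ≤ |s| ^ β`. -/
theorem abs_fwdDiff_iter_le_rpow {r : ℕ} {f : ℝ → ℝ} (hf : ContDiff ℝ r f) {M B : ℝ}
    (hM : ∀ x, |iteratedDeriv r f x| ≤ M) (hB : ∀ x, |f x| ≤ B) {β : ℝ} (hβ : 0 < β)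
    (hr : β ≤ r) (s x : ℝ) : |(fwdDiff s)^[r] f x| ≤ (M + 2 ^ r * B) * |s| ^ β := by
  have hM0 : 0 ≤ M := (abs_nonneg _).trans (hM 0)
  have hB0 : 0 ≤ B := (abs_nonneg _).trans (hB 0)
  have hp : 0 ≤ |s| ^ β := Real.rpow_nonneg (abs_nonneg _) _
  rcases le_total |s| 1 with h | h
  · have h1 : |s| ^ r ≤ |s| ^ β := by
      rw [← Real.rpow_natCast]
      rcases (abs_nonneg s).eq_or_lt with h0 | h0
      · rw [← h0, Real.zero_rpow hβ.ne', Real.zero_rpow (hβ.trans_le hr).ne']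
      · exact Real.rpow_le_rpow_of_exponent_ge h0 h hr
    calc _ ≤ |s| ^ r * M := abs_fwdDiff_iter_le_of_iteratedDeriv r hf hM s x
      _ ≤ |s| ^ β * M := by gcongr
      _ ≤ _ := by nlinarith [mul_nonneg (mul_nonneg (pow_nonneg zero_le_two r) hB0) hp]
  · have h1 : 1 ≤ |s| ^ β := Real.one_le_rpow h hβ.le
    calc _ ≤ 2 ^ r * B := abs_fwdDiff_iter_le_of_bound r hB s x
      _ ≤ 2 ^ r * B * |s| ^ β := le_mul_of_one_le_right (by positivity) h1
      _ ≤ _ := by nlinarith [mul_nonneg hM0 hp]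

theorem fwdDiff_iter_comp_affine (r : ℕ) (f : ℝ → ℝ) (a w s x : ℝ) :
    (fwdDiff s)^[r] (fun x => f ((x - a) / w)) x = (fwdDiff (s / w))^[r] f ((x - a) / w) := by
  rw [fwdDiff_iter_eq_sum_shift, fwdDiff_iter_eq_sum_shift]
  refine Finset.sum_congr rfl fun k _ => ?_
  congr 2
  simp only [nsmul_eq_mul]
  ring

theorem fwdDiff_iter_linear {r : ℕ} (hr : 2 ≤ r) (ε s : ℝ) :
    (fwdDiff s)^[r] (fun y : ℝ => ε * y) = 0 := by
  obtain ⟨k, rfl⟩ := Nat.exists_eq_add_of_le' hr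
  rw [Function.iterate_add_apply]
  have h2 : (fwdDiff s)^[2] (fun y : ℝ => ε * y) = 0 := by
    ext y
    simp [fwdDiff]
    ring
  rw [h2]
  ext x
  -- The bound with `B = 0` shows that iterated differences of zero vanish.
  have := abs_fwdDiff_iter_le_of_bound k (f := 0) (B := 0) (by simp) s x
  simpa using this

theorem fwdDiff_iter_constant {r : ℕ} (hr : 1 ≤ r) (c s : ℝ) :
    (fwdDiff s)^[r] (fun _ : ℝ => c) = 0 := by
  obtain ⟨k, rfl⟩ := Nat.exists_eq_add_of_le' hr
  rw [Function.iterate_add_apply]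
  have h2 : (fwdDiff s)^[1] (fun _ : ℝ => c) = 0 := by
    ext y
    simp [fwdDiff]
  rw [h2]
  ext x
  have := abs_fwdDiff_iter_le_of_bound k (f := 0) (B := 0) (by simp) s x
  simpa using this

theorem dirDiff_fst (r : ℕ) (h : ℝ) (f : ℝ × ℝ → ℝ) (p : ℝ × ℝ) :
    dirDiff r h (1, 0) f p = (fwdDiff h)^[r] (fun x => f (x, p.2)) p.1 := by
  rw [fwdDiff_iter_eq_sum_shift, dirDiff]
  refine Finset.sum_congr rfl fun k _ => ?_
  have : p + ((k : ℝ) * h) • ((1, 0) : ℝ × ℝ) = (p.1 + k • h, p.2) := by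
    ext <;> simp
  rw [this]
  simp only [zsmul_eq_mul]
  push_cast
  ring

theorem dirDiff_snd (r : ℕ) (h : ℝ) (f : ℝ × ℝ → ℝ) (p : ℝ × ℝ) :
    dirDiff r h (0, 1) f p = (fwdDiff h)^[r] (fun y => f (p.1, y)) p.2 := by
  rw [fwdDiff_iter_eq_sum_shift, dirDiff]
  refine Finset.sum_congr rfl fun k _ => ?_
  have : p + ((k : ℝ) * h) • ((0, 1) : ℝ × ℝ) = (p.1, p.2 + k • h) := by
    ext <;> simp
  rw [this]
  simp only [zsmul_eq_mul]
  push_cast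
  ring

/-- By convexity every node `p + k h e` lies on a segment inside `A`, so the differences see only
the restriction to `A`. -/
theorem dirDiff_congr {A : Set (ℝ × ℝ)} (hA : Convex ℝ A) {f g : ℝ × ℝ → ℝ}
    (hfg : ∀ p ∈ A, f p = g p) {r : ℕ} {h : ℝ} {e p : ℝ × ℝ} (hp : p ∈ diffDomain A r h e) :
    dirDiff r h e f p = dirDiff r h e g p := by
  refine Finset.sum_congr rfl fun k hk => ?_
  rw [hfg]
  have hkr : (k : ℝ) ≤ r := by exact_mod_cast Nat.lt_succ_iff.1 (Finset.mem_range.1 hk)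
  rcases Nat.eq_zero_or_pos r with h0 | h0
  · have : (k : ℝ) = 0 := le_antisymm (by simpa [h0] using hkr) (Nat.cast_nonneg k)
    simpa [this] using hp.1
  · have hr : (0 : ℝ) < r := by exact_mod_cast h0
    have h1 := hA.add_smul_mem hp.1 hp.2 (t := (k : ℝ) / r)
      ⟨by positivity, (div_le_one hr).2 hkr⟩
    rw [smul_smul] at h1
    convert h1 using 3
    field_simp

end Differences

/-! ### A sufficient condition for membership in a Besov ball -/

section Besov

variable {A : Set (ℝ × ℝ)} {β₁ β₂ : ℝ} {f : ℝ × ℝ → ℝ}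

theorem measurableSet_diffDomain (hA : MeasurableSet A) (r : ℕ) (h : ℝ) (e : ℝ × ℝ) :
    MeasurableSet (diffDomain A r h e) :=
  hA.inter ((measurable_id.add_const _) hA)

theorem modulus_le (hA : MeasurableSet A) {β : ℝ} (hβ : 0 < β) {r : ℕ} {e : ℝ × ℝ} {K : ℝ}
    (hK : 0 ≤ K) (hf : ∀ h, ∀ p ∈ diffDomain A r h e, |dirDiff r h e f p| ≤ K * |h| ^ β)
    {t : ℝ} (ht : 0 < t) :
    ENNReal.ofReal (t ^ (-β)) * modulus A r e f t ≤
      volume A ^ (2 : ℝ)⁻¹ * ENNReal.ofReal K := by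
  have hmod : modulus A r e f t ≤ volume A ^ (2 : ℝ)⁻¹ * ENNReal.ofReal (K * t ^ β) := by
    refine iSup₂_le fun h hh => ?_
    refine (eLpNorm_le_of_ae_bound (C := K * t ^ β) ?_).trans ?_
    · refine ae_restrict_of_forall_mem (measurableSet_diffDomain hA r h e) fun p hp => ?_
      refine (hf h p hp).trans ?_
      gcongr
    · rw [Measure.restrict_apply_univ]
      simp only [ENNReal.toReal_ofNat]
      gcongr
      exact fun p hp => hp.1
  calc _ ≤ ENNReal.ofReal (t ^ (-β)) * (volume A ^ (2 : ℝ)⁻¹ * ENNReal.ofReal (K * t ^ β)) := by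
        gcongr
    _ = volume A ^ (2 : ℝ)⁻¹ * (ENNReal.ofReal (t ^ (-β)) * ENNReal.ofReal (K * t ^ β)) := by ring
    _ = _ := by
      rw [← ENNReal.ofReal_mul (by positivity), Real.rpow_neg ht.le]
      congr 2
      have := (Real.rpow_pos_of_pos ht β).ne'
      field_simp

/-- On a set of finite volume, `L²` norms are at most `volume A ^ (1/2)` times sup norms, so
pointwise Hölder-type bounds suffice. -/
theorem mem_besovBall_of_bounds (hA : MeasurableSet A) (hAfin : volume A ≠ ⊤) (hβ₁ : 0 < β₁)
    (hβ₂ : 0 < β₂) (hfm : Measurable f) {K₁ K₂ B L : ℝ} (hK₁ : 0 ≤ K₁) (hK₂ : 0 ≤ K₂)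
    (hB : 0 ≤ B)
    (h₁ : ∀ h, ∀ p ∈ diffDomain A (⌊β₁⌋₊ + 1) h (1, 0),
      |dirDiff (⌊β₁⌋₊ + 1) h (1, 0) f p| ≤ K₁ * |h| ^ β₁)
    (h₂ : ∀ h, ∀ p ∈ diffDomain A (⌊β₂⌋₊ + 1) h (0, 1),
      |dirDiff (⌊β₂⌋₊ + 1) h (0, 1) f p| ≤ K₂ * |h| ^ β₂)
    (h₃ : ∀ p ∈ A, |f p| ≤ B)
    (hL : volume A ^ (2 : ℝ)⁻¹ * ENNReal.ofReal (K₁ + K₂ + B) ≤ ENNReal.ofReal L) :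
    f ∈ besovBall A β₁ β₂ L := by
  have hbound : ∀ᵐ p ∂(volume.restrict A), ‖f p‖ ≤ B := ae_restrict_of_forall_mem hA h₃
  have : IsFiniteMeasure (volume.restrict A) := ⟨by
    rw [Measure.restrict_apply_univ]; exact hAfin.lt_top⟩
  refine ⟨MemLp.of_bound hfm.aestronglyMeasurable B hbound, le_trans ?_ hL⟩
  rw [ENNReal.ofReal_add (by positivity) hB, ENNReal.ofReal_add hK₁ hK₂, mul_add, mul_add]
  unfold besovNorm
  gcongr
  · exact iSup₂_le fun t ht =>
      add_le_add (modulus_le hA hβ₁ hK₁ h₁ ht) (modulus_le hA hβ₂ hK₂ h₂ ht)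
  · refine (eLpNorm_le_of_ae_bound hbound).trans_eq ?_
    rw [Measure.restrict_apply_univ]
    simp only [ENNReal.toReal_ofNat]

end Besov

/-! ### Sums of translated bumps -/

section Bumps

/-- A smooth bump supported in `[1/6, 5/6]` and equal to `1` on `[1/4, 3/4]`. -/
noncomputable def unitBump : ContDiffBump (1 / 2 : ℝ) where
  rIn := 1 / 4
  rOut := 1 / 3
  rIn_pos := by norm_num
  rIn_lt_rOut := by norm_num

theorem iteratedDeriv_unitBump_eq_zero (r : ℕ) {u : ℝ} (hu : u ∉ Set.Ioo (0 : ℝ) 1) :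
    iteratedDeriv r unitBump u = 0 := by
  by_contra h
  have h1 : u ∈ Function.support (iteratedFDeriv ℝ r unitBump) := by
    rw [Function.mem_support]
    intro h0
    exact h (by rw [iteratedDeriv_eq_iteratedFDeriv, h0]; rfl)
  have h2 := support_iteratedFDeriv_subset r h1
  rw [ContDiffBump.tsupport_eq, Metric.mem_closedBall, Real.dist_eq, abs_le] at h2
  have h3 : unitBump.rOut = 1 / 3 := rfl
  rw [h3] at h2
  exact hu ⟨by linarith [h2.1], by linarith [h2.2]⟩

theorem unitBump_eq_zero {u : ℝ} (hu : u ∉ Set.Ioo (0 : ℝ) 1) : unitBump u = 0 := by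
  simpa using iteratedDeriv_unitBump_eq_zero 0 hu

theorem unitBump_eq_one {u : ℝ} (hu : u ∈ Set.Icc (1 / 4 : ℝ) (3 / 4)) : unitBump u = 1 := by
  apply ContDiffBump.one_of_mem_closedBall
  rw [Metric.mem_closedBall, Real.dist_eq, abs_le]
  have h3 : unitBump.rIn = 1 / 4 := rfl
  rw [h3]
  exact ⟨by linarith [hu.1], by linarith [hu.2]⟩

theorem exists_bound_iteratedDeriv_unitBump (r : ℕ) :
    ∃ M, 0 ≤ M ∧ ∀ u, |iteratedDeriv r unitBump u| ≤ M := by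
  have hc : Continuous (iteratedDeriv r unitBump) :=
    (unitBump.contDiff (n := r)).continuous_iteratedDeriv' r
  obtain ⟨M, hM⟩ := (isCompact_Icc (a := (0 : ℝ)) (b := 1)).exists_bound_of_continuousOn
    hc.continuousOn
  refine ⟨max M 0, le_max_right _ _, fun u => ?_⟩
  by_cases hu : u ∈ Set.Ioo (0 : ℝ) 1
  · exact (hM u (Set.Ioo_subset_Icc_self hu)).trans (le_max_left _ _)
  · rw [iteratedDeriv_unitBump_eq_zero r hu]; simp

/-- A linear combination of integer translates of `f`. -/
def translates (f : ℝ → ℝ) {m : ℕ} (c : Fin m → ℝ) (u : ℝ) : ℝ := ∑ j, c j * f (u - (j : ℕ))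

variable {m m₁ m₂ : ℕ}

/-- At most one translate is nonzero at a given point, so the bound does not grow with `m`. -/
theorem abs_translates_le {f : ℝ → ℝ} (hf : ∀ u ∉ Set.Ioo (0 : ℝ) 1, f u = 0) {M B : ℝ}
    (hM : ∀ u, |f u| ≤ M) {c : Fin m → ℝ} (hB0 : 0 ≤ B) (hc : ∀ j, |c j| ≤ B) (u : ℝ) :
    |translates f c u| ≤ B * M := by
  have hM0 : 0 ≤ M := (abs_nonneg _).trans (hM 0)
  unfold translates
  by_cases h : ∃ j : Fin m, u - (j : ℕ) ∈ Set.Ioo (0 : ℝ) 1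
  · obtain ⟨j, hj⟩ := h
    rw [Finset.sum_eq_single j, abs_mul]
    · exact mul_le_mul (hc j) (hM _) (abs_nonneg _) hB0
    · intro i _ hij
      rw [hf, mul_zero]
      intro hi
      apply hij
      have h1 : (i : ℕ) < (j : ℕ) + 1 := by
        have : ((i : ℕ) : ℝ) < ((j : ℕ) : ℝ) + 1 := by linarith [hi.1, hj.2]
        exact_mod_cast this
      have h2 : (j : ℕ) < (i : ℕ) + 1 := by
        have : ((j : ℕ) : ℝ) < ((i : ℕ) : ℝ) + 1 := by linarith [hi.2, hj.1]
        exact_mod_cast this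
      exact Fin.ext (by omega)
    · intro h; exact absurd (Finset.mem_univ j) h
  · push Not at h
    rw [Finset.sum_eq_zero fun j _ => by rw [hf _ (h j), mul_zero]]
    simpa using mul_nonneg hB0 hM0

theorem contDiff_translates {f : ℝ → ℝ} {r : ℕ} (hf : ContDiff ℝ r f) (c : Fin m → ℝ) :
    ContDiff ℝ r (translates f c) := by
  unfold translates
  exact ContDiff.sum fun j _ => contDiff_const.mul (hf.comp (contDiff_id.sub contDiff_const))

theorem iteratedDeriv_translates {f : ℝ → ℝ} {r : ℕ} (hf : ContDiff ℝ r f) (c : Fin m → ℝ)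
    (u : ℝ) : iteratedDeriv r (translates f c) u = translates (iteratedDeriv r f) c u := by
  unfold translates
  have h (j : Fin m) : ContDiff ℝ r fun u => c j * f (u - (j : ℕ)) :=
    contDiff_const.mul (hf.comp (contDiff_id.sub contDiff_const))
  rw [iteratedDeriv_fun_sum fun j _ => (h j).contDiffAt]
  refine Finset.sum_congr rfl fun j _ => ?_
  rw [iteratedDeriv_const_mul_field, iteratedDeriv_comp_sub_const]

theorem translates_unitBump_eq_zero {c : Fin m → ℝ} {u : ℝ} (hu : u ∉ Set.Ioo (0 : ℝ) m) :
    translates unitBump c u = 0 := by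
  refine Finset.sum_eq_zero fun j _ => ?_
  rw [unitBump_eq_zero, mul_zero]
  intro h
  have h1 : ((j : ℕ) : ℝ) + 1 ≤ m := by exact_mod_cast j.2
  have h2 : (0 : ℝ) ≤ ((j : ℕ) : ℝ) := Nat.cast_nonneg _
  exact hu ⟨by linarith [h.1], by linarith [h.2]⟩

theorem abs_translates_unitBump_le {c : Fin m → ℝ} (hc : ∀ j, |c j| ≤ 1) (u : ℝ) :
    |translates unitBump c u| ≤ 1 := by
  refine (abs_translates_le (M := 1) (fun u hu => unitBump_eq_zero hu) (fun u => ?_)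
    zero_le_one hc u).trans_eq (one_mul 1)
  rw [abs_of_nonneg unitBump.nonneg]
  exact unitBump.le_one

/-- The constant is uniform in the number of translates and in the coefficients, hence in the grid
and the vertex. Real coefficients, rather than bits, allow the values of the bumps in the other
variable to be used as coefficients. -/
theorem exists_smoothness_constant {β : ℝ} (hβ : 0 < β) {r : ℕ} (hr : β ≤ r) :
    ∃ C, 0 ≤ C ∧ ∀ (m : ℕ) (c : Fin m → ℝ), (∀ j, |c j| ≤ 1) → ∀ s u,
      |(fwdDiff s)^[r] (translates unitBump c) u| ≤ C * |s| ^ β := by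
  obtain ⟨M, hM0, hM⟩ := exists_bound_iteratedDeriv_unitBump r
  refine ⟨M + 2 ^ r * 1, by positivity, fun m c hc s u => ?_⟩
  have hψ : ContDiff ℝ r unitBump := unitBump.contDiff
  refine abs_fwdDiff_iter_le_rpow (contDiff_translates hψ c) (fun x => ?_) (fun x => ?_) hβ hr s u
  · rw [iteratedDeriv_translates hψ, ← one_mul M]
    exact abs_translates_le (fun u hu => iteratedDeriv_unitBump_eq_zero r hu) hM zero_le_one hc x
  · exact abs_translates_unitBump_le hc x

theorem hasDerivAt_translates (c : Fin m → ℝ) (u : ℝ) :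
    HasDerivAt (translates unitBump c) (translates (deriv unitBump) c u) u := by
  have hψ : ContDiff ℝ (1 : ℕ) unitBump := unitBump.contDiff
  have h := (contDiff_translates hψ c).differentiable (by simp) u
  have h2 := iteratedDeriv_translates hψ c u
  rw [iteratedDeriv_one, iteratedDeriv_one] at h2
  rw [← h2]
  exact h.hasDerivAt

/-- The value of a bit. -/
def bitValue (b : Bool) : ℝ := bif b then 1 else 0

theorem abs_bitValue_le (b : Bool) : |bitValue b| ≤ 1 := by
  cases b <;> simp [bitValue]

/-- The sum of the bumps of the unit cells of a grid that are selected by `θ`. -/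
noncomputable def bumpGrid (θ : Fin m₁ × Fin m₂ → Bool) (u v : ℝ) : ℝ :=
  translates unitBump (fun k => translates unitBump (fun j => bitValue (θ (j, k))) u) v

/-- Exchanging the two sums lets the one-dimensional estimates act in `u` with `v` frozen. -/
theorem bumpGrid_eq (θ : Fin m₁ × Fin m₂ → Bool) (u v : ℝ) :
    bumpGrid θ u v =
      translates unitBump (fun j => translates unitBump (fun k => bitValue (θ (j, k))) v) u := by
  simp only [bumpGrid, translates, Finset.sum_mul]
  rw [Finset.sum_comm]
  exact Finset.sum_congr rfl fun j _ => Finset.sum_congr rfl fun k _ => by ring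

theorem bumpGrid_eq_sum (θ : Fin m₁ × Fin m₂ → Bool) (u v : ℝ) :
    bumpGrid θ u v = ∑ c : Fin m₁ × Fin m₂,
      bitValue (θ c) * (unitBump (u - (c.1 : ℕ)) * unitBump (v - (c.2 : ℕ))) := by
  simp only [bumpGrid_eq, translates, Finset.sum_mul, Fintype.sum_prod_type]
  exact Finset.sum_congr rfl fun j _ => Finset.sum_congr rfl fun k _ => by ring

theorem abs_bumpGrid_le (θ : Fin m₁ × Fin m₂ → Bool) (u v : ℝ) : |bumpGrid θ u v| ≤ 1 :=
  abs_translates_unitBump_le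
    (fun _ => abs_translates_unitBump_le (fun _ => abs_bitValue_le _) u) v

theorem bumpGrid_nonneg (θ : Fin m₁ × Fin m₂ → Bool) (u v : ℝ) : 0 ≤ bumpGrid θ u v := by
  rw [bumpGrid_eq_sum]
  refine Finset.sum_nonneg fun c _ => mul_nonneg ?_ (mul_nonneg unitBump.nonneg unitBump.nonneg)
  cases θ c <;> simp [bitValue]

theorem bumpGrid_eq_zero {θ : Fin m₁ × Fin m₂ → Bool} {u v : ℝ}
    (hv : v ∉ Set.Ioo (0 : ℝ) m₂) : bumpGrid θ u v = 0 :=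
  translates_unitBump_eq_zero hv

theorem abs_bumpGrid_flipAt_sub (θ : Fin m₁ × Fin m₂ → Bool) (c : Fin m₁ × Fin m₂) (u v : ℝ) :
    |bumpGrid (flipAt c θ) u v - bumpGrid θ u v| =
      unitBump (u - (c.1 : ℕ)) * unitBump (v - (c.2 : ℕ)) := by
  rw [bumpGrid_eq_sum, bumpGrid_eq_sum, ← Finset.sum_sub_distrib, Finset.sum_eq_single c]
  · rw [← sub_mul, abs_mul, abs_of_nonneg (mul_nonneg unitBump.nonneg unitBump.nonneg)]
    have : |bitValue (flipAt c θ c) - bitValue (θ c)| = 1 := by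
      cases h : θ c <;> simp [flipAt, bitValue, h]
    rw [this, one_mul]
  · intro c' _ hc
    simp [flipAt, hc]
  · intro h; exact absurd (Finset.mem_univ c) h

/-- The derivative of `bumpGrid` in the second variable. -/
noncomputable def bumpGridDeriv (θ : Fin m₁ × Fin m₂ → Bool) (u v : ℝ) : ℝ :=
  translates (deriv unitBump) (fun k => translates unitBump (fun j => bitValue (θ (j, k))) u) v

theorem hasDerivAt_bumpGrid (θ : Fin m₁ × Fin m₂ → Bool) (u v : ℝ) :
    HasDerivAt (bumpGrid θ u) (bumpGridDeriv θ u v) v :=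
  hasDerivAt_translates _ v

theorem continuous_deriv_unitBump : Continuous (deriv unitBump) :=
  (unitBump.contDiff (n := 1)).continuous_deriv le_rfl

theorem continuous_bumpGridDeriv (θ : Fin m₁ × Fin m₂ → Bool) :
    Continuous fun q : ℝ × ℝ => bumpGridDeriv θ q.1 q.2 := by
  have h1 := continuous_deriv_unitBump
  have h2 := unitBump.continuous
  unfold bumpGridDeriv translates
  fun_prop

theorem exists_bound_bumpGridDeriv :
    ∃ D, 0 < D ∧ ∀ (m₁ m₂ : ℕ) (θ : Fin m₁ × Fin m₂ → Bool) (u v : ℝ),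
      |bumpGridDeriv θ u v| ≤ D := by
  obtain ⟨M, hM0, hM⟩ := exists_bound_iteratedDeriv_unitBump 1
  refine ⟨M + 1, by positivity, fun m₁ m₂ θ u v => ?_⟩
  have h : |bumpGridDeriv θ u v| ≤ 1 * M := by
    refine abs_translates_le (fun u hu => ?_) (fun u => ?_) zero_le_one
      (fun _ => abs_translates_unitBump_le (fun _ => abs_bitValue_le _) u) v
    · simpa using iteratedDeriv_unitBump_eq_zero 1 hu
    · simpa using hM u
  linarith

end Bumps

/-! ### Minimax lower bound from a hypercube of lifetime distributions -/

section LowerBound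

theorem risk_eq (A : Set (ℝ × ℝ)) (n : ℕ) (ν : Measure (ℝ × ℝ)) (G : (Fin n → Obs) → ℝ × ℝ → ℝ)
    (κ : Kernel ℝ ℝ) : risk A n ν G κ =
      ∫⁻ s, (∫⁻ p in A, ‖G s p - condCdf κ p‖ₑ ^ 2) ∂(sampleLaw n ν κ) := by
  unfold risk
  refine lintegral_congr fun s => ?_
  have := eLpNorm_nnreal_pow_eq_lintegral (p := 2) (f := fun p => G s p - condCdf κ p)
    (μ := volume.restrict A) two_ne_zero
  simpa using this

theorem ofReal_sq_half_le {u v γ : ℝ} (h : |u - v| = γ) :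
    ENNReal.ofReal (γ ^ 2 / 2) ≤ ‖u‖ₑ ^ 2 + ‖v‖ₑ ^ 2 := by
  rw [← ofReal_norm, ← ofReal_norm, ← ENNReal.ofReal_pow (norm_nonneg _),
    ← ENNReal.ofReal_pow (norm_nonneg _), ← ENNReal.ofReal_add (by positivity) (by positivity)]
  apply ENNReal.ofReal_le_ofReal
  rw [← h, sq_abs, Real.norm_eq_abs, Real.norm_eq_abs, sq_abs, sq_abs]
  nlinarith [sq_nonneg (u + v)]

/-- Two families of sets play different roles: `C c` contains every point affected by bit `c` and
bounds the information, while `I c` is where the change is exactly `γ` and yields the loss. Only the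
`I c` must be disjoint, so that their losses add up to at most the full risk. -/
theorem minimaxRisk_ge_of_hypercube {ι : Type*} [Fintype ι] [DecidableEq ι]
    {A : Set (ℝ × ℝ)} {β₁ β₂ L : ℝ} {n : ℕ} {ν : Measure (ℝ × ℝ)} [IsProbabilityMeasure ν]
    (κ : (ι → Bool) → Kernel ℝ ℝ) (hκ : ∀ θ, κ θ ∈ lifetimeClass A β₁ β₂ L)
    {C I : ι → Set (ℝ × ℝ)} (hC : ∀ c, MeasurableSet (C c)) (hI : ∀ c, MeasurableSet (I c))
    (hIA : ∀ c, I c ⊆ A) (hdisj : Pairwise (Function.onFun Disjoint I)) {γ η : ℝ} (hη : 0 < η)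
    (hout : ∀ θ c, ∀ p ∉ C c, condCdf (κ (flipAt c θ)) p = condCdf (κ θ) p)
    (hin : ∀ θ c, ∀ p ∈ C c, η ≤ condCdf (κ θ) p ∧ condCdf (κ θ) p ≤ 1 / 2 ∧
      |condCdf (κ (flipAt c θ)) p - condCdf (κ θ) p| ≤ γ)
    (hsep : ∀ θ c, ∀ p ∈ I c, |condCdf (κ (flipAt c θ)) p - condCdf (κ θ) p| = γ)
    {v : ℝ≥0∞} (hv : ∀ c, volume (I c) = v) (hvt : v ≠ ⊤)
    (hinfo : ∀ c, (1 + ENNReal.ofReal (2 * γ ^ 2 / η) * ν (C c)) ^ n ≤ 2) :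
    Fintype.card ι * (ENNReal.ofReal (γ ^ 2 / 2) * v / 2) / 2 ≤ minimaxRisk A β₁ β₂ L n ν := by
  refine le_iInf₂ fun G hG => ?_
  have hMK (θ : ι → Bool) : IsMarkovKernel (κ θ) := (hκ θ).1
  have hmeas (θ : ι → Bool) : Measurable fun q : (Fin n → Obs) × (ℝ × ℝ) =>
      ‖G q.1 q.2 - condCdf (κ θ) q.2‖ₑ ^ 2 := by
    have h1 : Measurable fun q : (Fin n → Obs) × (ℝ × ℝ) => G q.1 q.2 := hG
    have h2 := (measurable_condCdf (κ := κ θ)).comp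
      (measurable_snd : Measurable fun q : (Fin n → Obs) × (ℝ × ℝ) => q.2)
    exact (h1.sub h2).enorm.pow_const 2
  have hloss (θ : ι → Bool) (c : ι) :
      Measurable fun s => ∫⁻ p in I c, ‖G s p - condCdf (κ θ) p‖ₑ ^ 2 :=
    (hmeas θ).lintegral_prod_right'
  refine hypercube_bound
    (fun θ c => ∫⁻ s, (∫⁻ p in I c, ‖G s p - condCdf (κ θ) p‖ₑ ^ 2) ∂(sampleLaw n ν (κ θ)))
    _ _ (fun θ c => ?_) (fun θ => ?_)
  · have h0 (p : ℝ × ℝ) (hp : condCdf (κ θ) p = 0) : condCdf (κ (flipAt c θ)) p = 0 := by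
      by_cases h : p ∈ C c
      · linarith [(hin θ c p h).1]
      · rw [hout θ c p h, hp]
    have h1 (p : ℝ × ℝ) (hp : condCdf (κ θ) p = 1) : condCdf (κ (flipAt c θ)) p = 1 := by
      by_cases h : p ∈ C c
      · linarith [(hin θ c p h).2.1]
      · rw [hout θ c p h, hp]
    have hQ : obsLaw ν (κ (flipAt c θ)) = _ := obsLaw_eq_withDensity (ν := ν) h0 h1
    have hQp : IsProbabilityMeasure
        ((obsLaw ν (κ θ)).withDensity (likelihoodRatio (κ θ) (κ (flipAt c θ)))) := by
      rw [← hQ]; infer_instance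
    simp only [sampleLaw]
    rw [hQ]
    refine two_point_bound (obsLaw ν (κ θ)) measurable_likelihoodRatio ?_ (hloss θ c)
      (hloss _ c) (ENNReal.mul_ne_top ENNReal.ofReal_ne_top hvt) (fun s => ?_)
    · refine le_trans ?_ (hinfo c)
      gcongr
      exact lintegral_likelihoodRatio_sq_le (hC c) hη (hout θ c) (hin θ c)
    · have hm : Measurable fun p => ‖G s p - condCdf (κ θ) p‖ₑ ^ 2 :=
        (hmeas θ).comp measurable_prodMk_left
      rw [← lintegral_add_left hm, ← hv c, ← setLIntegral_const]
      refine setLIntegral_mono' (hI c) fun p hp => ofReal_sq_half_le ?_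
      rw [← hsep θ c p hp]
      congr 1
      ring
  · calc _ ≤ risk A n ν G (κ θ) := by
          rw [risk_eq, ← lintegral_finsetSum _ fun c _ => hloss θ c]
          refine lintegral_mono fun s => ?_
          rw [← tsum_fintype (L := SummationFilter.unconditional ι), ← lintegral_iUnion hI hdisj]
          exact lintegral_mono_set (Set.iUnion_subset hIA)
      _ ≤ _ := le_iSup₂ (f := fun κ' (_ : κ' ∈ lifetimeClass A β₁ β₂ L) => risk A n ν G κ')
        (κ θ) (hκ θ)

end LowerBound

/-! ### Lifetimes with a prescribed conditional density on an interval -/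

section Lifetime

/-- The kernel with density `ρ x` on `(0, b]` and an atom of mass `1 - m` at `b + 1`. -/
noncomputable def lifetimeKernel (ρ : ℝ → ℝ → ℝ) (b m : ℝ) : Kernel ℝ ℝ :=
  Kernel.withDensity (Kernel.const ℝ (volume.restrict (Set.Ioc 0 b)))
    (fun x y => ENNReal.ofReal (ρ x y)) +
  Kernel.const ℝ (ENNReal.ofReal (1 - m) • Measure.dirac (b + 1))

variable {ρ H : ℝ → ℝ → ℝ} {b m : ℝ}

theorem lifetimeKernel_apply (hρ : Continuous fun q : ℝ × ℝ => ρ q.1 q.2) (x : ℝ) (s : Set ℝ)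
    (hs : MeasurableSet s) : lifetimeKernel ρ b m x s =
      (∫⁻ y in s ∩ Set.Ioc 0 b, ENNReal.ofReal (ρ x y)) +
        ENNReal.ofReal (1 - m) * Measure.dirac (b + 1) s := by
  have hm : Measurable (Function.uncurry fun x y => ENNReal.ofReal (ρ x y)) :=
    hρ.measurable.ennreal_ofReal
  rw [lifetimeKernel, add_apply, Measure.add_apply, Kernel.withDensity_apply _ hm,
    withDensity_apply _ hs, Kernel.const_apply, Kernel.const_apply, Measure.smul_apply,
    smul_eq_mul, Measure.restrict_restrict hs]

theorem lintegral_Ioc_density (hρ : Continuous fun q : ℝ × ℝ => ρ q.1 q.2)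
    (hρ0 : ∀ x y, 0 ≤ ρ x y) (hH : ∀ x y, HasDerivAt (H x) (ρ x y) y) (hH0 : ∀ x, H x 0 = 0)
    (x : ℝ) {t : ℝ} (ht : 0 ≤ t) :
    ∫⁻ y in Set.Ioc 0 t, ENNReal.ofReal (ρ x y) = ENNReal.ofReal (H x t) := by
  have hc : Continuous (ρ x) := hρ.comp (Continuous.prodMk_right x)
  have hi : IntervalIntegrable (ρ x) volume 0 t := hc.intervalIntegrable _ _
  rw [← ofReal_integral_eq_lintegral_ofReal ((intervalIntegrable_iff_integrableOn_Ioc_of_le ht).1 hi)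
    (Filter.Eventually.of_forall (hρ0 x)), ← intervalIntegral.integral_of_le ht,
    intervalIntegral.integral_eq_sub_of_hasDerivAt (fun y _ => hH x y) hi, hH0, sub_zero]

theorem lifetimeKernel_isMarkov (hρ : Continuous fun q : ℝ × ℝ => ρ q.1 q.2)
    (hρ0 : ∀ x y, 0 ≤ ρ x y) (hH : ∀ x y, HasDerivAt (H x) (ρ x y) y) (hH0 : ∀ x, H x 0 = 0)
    (hb : 0 ≤ b) (hHb : ∀ x, H x b = m) (hm0 : 0 ≤ m) (hm1 : m ≤ 1) :
    IsMarkovKernel (lifetimeKernel ρ b m) := by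
  refine ⟨fun x => ⟨?_⟩⟩
  rw [lifetimeKernel_apply hρ x _ MeasurableSet.univ, Set.univ_inter,
    lintegral_Ioc_density hρ hρ0 hH hH0 x hb, hHb, measure_univ, mul_one,
    ← ENNReal.ofReal_add hm0 (sub_nonneg.2 hm1)]
  simp

theorem lifetimeKernel_Iic_zero (hρ : Continuous fun q : ℝ × ℝ => ρ q.1 q.2) (hb : 0 ≤ b)
    (x : ℝ) : lifetimeKernel ρ b m x (Set.Iic 0) = 0 := by
  have h1 : Set.Iic 0 ∩ Set.Ioc 0 b = ∅ := by
    ext y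
    simp only [Set.mem_inter_iff, Set.mem_Iic, Set.mem_Ioc, Set.mem_empty_iff_false, iff_false]
    rintro ⟨h1, h2, -⟩
    linarith
  have h2 : b + 1 ∉ Set.Iic (0 : ℝ) := by
    simp only [Set.mem_Iic, not_le]; linarith
  rw [lifetimeKernel_apply hρ x _ measurableSet_Iic, h1, Measure.dirac_apply' _ measurableSet_Iic,
    Set.indicator_of_notMem h2]
  simp

/-- The formula covers the whole plane, not only `A`: observations may fall outside `A`, and
likelihood ratios must be known there too. Clamping to `[0, b]` reflects that the density part
charges only `(0, b]`. -/
theorem condCdf_lifetimeKernel (hρ : Continuous fun q : ℝ × ℝ => ρ q.1 q.2)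
    (hρ0 : ∀ x y, 0 ≤ ρ x y) (hH : ∀ x y, HasDerivAt (H x) (ρ x y) y) (hH0 : ∀ x, H x 0 = 0)
    (hb : 0 ≤ b) (hHb : ∀ x, H x b = m) (hm0 : 0 ≤ m) (hm1 : m ≤ 1) (p : ℝ × ℝ) :
    condCdf (lifetimeKernel ρ b m) p =
      H p.1 (max 0 (min p.2 b)) + if b + 1 ≤ p.2 then 1 - m else 0 := by
  have := lifetimeKernel_isMarkov hρ hρ0 hH hH0 hb hHb hm0 hm1
  set t := max 0 (min p.2 b) with ht
  have ht0 : 0 ≤ t := le_max_left _ _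
  have hset : Set.Iic p.2 ∩ Set.Ioc 0 b = Set.Ioc 0 t := by
    ext y
    simp only [Set.mem_inter_iff, Set.mem_Iic, Set.mem_Ioc, ht, le_max_iff, le_min_iff]
    constructor
    · rintro ⟨h1, h2, h3⟩; exact ⟨h2, Or.inr ⟨h1, h3⟩⟩
    · rintro ⟨h2, h1 | ⟨h1, h3⟩⟩
      · linarith
      · exact ⟨h1, h2, h3⟩
  have hHt : 0 ≤ H p.1 t := by
    have hmono : Monotone (H p.1) := monotone_of_deriv_nonneg
      (fun y => (hH p.1 y).differentiableAt) fun y => by rw [(hH p.1 y).deriv]; exact hρ0 _ _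
    rw [← hH0 p.1]
    exact hmono ht0
  rw [condCdf_eq_real, measureReal_def, lifetimeKernel_apply hρ p.1 _ measurableSet_Iic, hset,
    lintegral_Ioc_density hρ hρ0 hH hH0 p.1 ht0, Measure.dirac_apply' _ measurableSet_Iic]
  by_cases h : b + 1 ≤ p.2
  · rw [if_pos h, Set.indicator_of_mem (Set.mem_Iic.2 h), Pi.one_apply, mul_one,
      ← ENNReal.ofReal_add hHt (sub_nonneg.2 hm1), ENNReal.toReal_ofReal]
    linarith
  · rw [if_neg h, Set.indicator_of_notMem (by simpa using h), mul_zero, add_zero, add_zero,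
      ENNReal.toReal_ofReal hHt]

end Lifetime

/-! ### The hypercube of lifetime distributions attached to a grid -/

section Grid

/-- The rectangle with corners `(j + s, k + s)` and `(j + t, k + t)` in the coordinates with origin
`(a, c)` and units `w₁` and `w₂`. -/
def gridCell (a c w₁ w₂ s t : ℝ) {m₁ m₂ : ℕ} (i : Fin m₁ × Fin m₂) : Set (ℝ × ℝ) :=
  rect (a + w₁ * ((i.1 : ℕ) + s)) (a + w₁ * ((i.1 : ℕ) + t))
    (c + w₂ * ((i.2 : ℕ) + s)) (c + w₂ * ((i.2 : ℕ) + t))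

/-- The distribution function, linear in `y` up to scaled bumps, that corresponds to `θ`. -/
noncomputable def gridCdf (ε γ a c w₁ w₂ : ℝ) {m₁ m₂ : ℕ} (θ : Fin m₁ × Fin m₂ → Bool)
    (x y : ℝ) : ℝ :=
  ε * y + γ * bumpGrid θ ((x - a) / w₁) ((y - c) / w₂)

/-- The derivative of `gridCdf` in `y`. -/
noncomputable def gridPdf (ε γ a c w₁ w₂ : ℝ) {m₁ m₂ : ℕ} (θ : Fin m₁ × Fin m₂ → Bool)
    (x y : ℝ) : ℝ :=
  ε + γ / w₂ * bumpGridDeriv θ ((x - a) / w₁) ((y - c) / w₂)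

variable {ε γ a c w₁ w₂ b : ℝ} {m₁ m₂ : ℕ}

theorem measurableSet_rect (a₁ b₁ a₂ b₂ : ℝ) : MeasurableSet (rect a₁ b₁ a₂ b₂) :=
  measurableSet_Icc.prod measurableSet_Icc

theorem volume_rect (a₁ b₁ a₂ b₂ : ℝ) :
    volume (rect a₁ b₁ a₂ b₂) = ENNReal.ofReal (b₁ - a₁) * ENNReal.ofReal (b₂ - a₂) := by
  rw [rect, Measure.volume_eq_prod, Measure.prod_prod, Real.volume_Icc, Real.volume_Icc]

theorem volume_gridCell (s t : ℝ) (i : Fin m₁ × Fin m₂) :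
    volume (gridCell a c w₁ w₂ s t i) =
      ENNReal.ofReal (w₁ * (t - s)) * ENNReal.ofReal (w₂ * (t - s)) := by
  rw [gridCell, volume_rect]
  congr 2 <;> ring

theorem mem_gridCell (hw₁ : 0 < w₁) (hw₂ : 0 < w₂) {s t : ℝ} {i : Fin m₁ × Fin m₂} {p : ℝ × ℝ} :
    p ∈ gridCell a c w₁ w₂ s t i ↔ (p.1 - a) / w₁ - (i.1 : ℕ) ∈ Set.Icc s t ∧
      (p.2 - c) / w₂ - (i.2 : ℕ) ∈ Set.Icc s t := by
  have key {w a x j : ℝ} (hw : 0 < w) :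
      x ∈ Set.Icc (a + w * (j + s)) (a + w * (j + t)) ↔ (x - a) / w - j ∈ Set.Icc s t := by
    simp only [Set.mem_Icc, le_sub_iff_add_le, sub_le_iff_le_add, le_div_iff₀ hw, div_le_iff₀ hw]
    constructor <;> rintro ⟨h1, h2⟩ <;> constructor <;> nlinarith
  rw [gridCell, rect, Set.mem_prod, key hw₁, key hw₂]

theorem gridCell_subset (hw₁ : 0 < w₁) (hw₂ : 0 < w₂) {s t : ℝ} (hs : 0 ≤ s) (ht : t ≤ 1)
    (i : Fin m₁ × Fin m₂) :
    gridCell a c w₁ w₂ s t i ⊆ rect a (a + m₁ * w₁) c (c + m₂ * w₂) := by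
  have key {w : ℝ} (hw : 0 < w) {m : ℕ} (j : Fin m) (a : ℝ) :
      Set.Icc (a + w * ((j : ℕ) + s)) (a + w * ((j : ℕ) + t)) ⊆ Set.Icc a (a + m * w) := by
    have h1 : ((j : ℕ) : ℝ) + 1 ≤ m := by exact_mod_cast j.2
    have h2 : (0 : ℝ) ≤ ((j : ℕ) : ℝ) := Nat.cast_nonneg _
    refine Set.Icc_subset_Icc ?_ ?_
    · have : 0 ≤ w * ((j : ℕ) + s) := by positivity
      linarith
    · have : w * ((j : ℕ) + t) ≤ w * m := by gcongr; linarith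
      linarith
  exact Set.prod_mono (key hw₁ i.1 a) (key hw₂ i.2 c)

/-- Full closed cells share edges; the strict inequalities exclude this. -/
theorem pairwise_disjoint_gridCell (hw₁ : 0 < w₁) (hw₂ : 0 < w₂) {s t : ℝ} (hs : 0 < s)
    (ht : t < 1) : Pairwise (Function.onFun Disjoint
      fun i : Fin m₁ × Fin m₂ => gridCell a c w₁ w₂ s t i) := by
  intro i i' hii
  refine Set.disjoint_left.2 fun p hp hp' => hii ?_
  rw [mem_gridCell hw₁ hw₂] at hp hp'
  have key {m : ℕ} {j j' : Fin m} {u : ℝ} (h : u - (j : ℕ) ∈ Set.Icc s t)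
      (h' : u - (j' : ℕ) ∈ Set.Icc s t) : j = j' := by
    have h1 : (j : ℕ) < (j' : ℕ) + 1 := by
      have : ((j : ℕ) : ℝ) < ((j' : ℕ) : ℝ) + 1 := by linarith [h.1, h'.2]
      exact_mod_cast this
    have h2 : (j' : ℕ) < (j : ℕ) + 1 := by
      have : ((j' : ℕ) : ℝ) < ((j : ℕ) : ℝ) + 1 := by linarith [h.2, h'.1]
      exact_mod_cast this
    exact Fin.ext (by omega)
  exact Prod.ext (key hp.1 hp'.1) (key hp.2 hp'.2)

theorem continuous_gridPdf (θ : Fin m₁ × Fin m₂ → Bool) :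
    Continuous fun q : ℝ × ℝ => gridPdf ε γ a c w₁ w₂ θ q.1 q.2 := by
  have h := (continuous_bumpGridDeriv θ).comp
    (f := fun q : ℝ × ℝ => ((q.1 - a) / w₁, (q.2 - c) / w₂)) (by fun_prop)
  exact continuous_const.add (continuous_const.mul h)

theorem hasDerivAt_gridCdf (θ : Fin m₁ × Fin m₂ → Bool) (x y : ℝ) :
    HasDerivAt (gridCdf ε γ a c w₁ w₂ θ x) (gridPdf ε γ a c w₁ w₂ θ x y) y := by
  have h1 : HasDerivAt (fun y => (y - c) / w₂) (1 / w₂) y :=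
    ((hasDerivAt_id y).sub_const c).div_const w₂
  have h2 := ((hasDerivAt_bumpGrid θ ((x - a) / w₁) ((y - c) / w₂)).comp y h1).const_mul γ
  have h3 := ((hasDerivAt_id y).const_mul ε).add h2
  refine (h3.congr_deriv ?_ : _)
  rw [gridPdf]
  ring

theorem gridPdf_nonneg (hw₂ : 0 < w₂) (hγ : 0 ≤ γ) {D : ℝ} (θ : Fin m₁ × Fin m₂ → Bool)
    (hD : ∀ u v, |bumpGridDeriv θ u v| ≤ D) (h : γ / w₂ * D ≤ ε) (x y : ℝ) :
    0 ≤ gridPdf ε γ a c w₁ w₂ θ x y := by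
  have h1 := (abs_le.1 (hD ((x - a) / w₁) ((y - c) / w₂))).1
  have h2 : γ / w₂ * (-D) ≤ γ / w₂ * bumpGridDeriv θ ((x - a) / w₁) ((y - c) / w₂) := by
    gcongr
  rw [gridPdf]
  linarith

theorem gridCdf_zero (hw₂ : 0 < w₂) (hc : 0 ≤ c) (θ : Fin m₁ × Fin m₂ → Bool) (x : ℝ) :
    gridCdf ε γ a c w₁ w₂ θ x 0 = 0 := by
  rw [gridCdf, bumpGrid_eq_zero]
  · ring
  · rintro ⟨h, -⟩
    have := div_nonpos_of_nonpos_of_nonneg (a := 0 - c) (by linarith) hw₂.le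
    linarith

/-- The bumps vanish at the end of the grid, so the mass on `(0, b]`, and with it the atom, is the
same for every `θ`. -/
theorem gridCdf_right (hw₂ : 0 < w₂) (hb : c + m₂ * w₂ = b) (θ : Fin m₁ × Fin m₂ → Bool) (x : ℝ) :
    gridCdf ε γ a c w₁ w₂ θ x b = ε * b := by
  rw [gridCdf, bumpGrid_eq_zero]
  · ring
  · rintro ⟨-, h⟩
    rw [← hb, add_sub_cancel_left, mul_div_cancel_right₀ _ hw₂.ne'] at h
    exact lt_irrefl _ h

/-- The lifetime distribution that corresponds to `θ`. -/
noncomputable def gridLifetime (ε γ a c w₁ w₂ b : ℝ) {m₁ m₂ : ℕ}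
    (θ : Fin m₁ × Fin m₂ → Bool) : Kernel ℝ ℝ :=
  lifetimeKernel (gridPdf ε γ a c w₁ w₂ θ) b (ε * b)

theorem dirDiff_fst_gridCdf_le {β C : ℝ} {r : ℕ} (hr : 1 ≤ r)
    (hC : ∀ (m : ℕ) (c : Fin m → ℝ), (∀ j, |c j| ≤ 1) → ∀ s u,
      |(fwdDiff s)^[r] (translates unitBump c) u| ≤ C * |s| ^ β)
    (hγ : 0 ≤ γ) (hw₁ : 0 < w₁) (θ : Fin m₁ × Fin m₂ → Bool) (h : ℝ) (p : ℝ × ℝ) :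
    |dirDiff r h (1, 0) (fun p => gridCdf ε γ a c w₁ w₂ θ p.1 p.2) p| ≤
      γ * C / w₁ ^ β * |h| ^ β := by
  set d : Fin m₁ → ℝ := fun j => translates unitBump (fun k => bitValue (θ (j, k)))
    ((p.2 - c) / w₂) with hd
  have hdec : (fun x => gridCdf ε γ a c w₁ w₂ θ x p.2) =
      (fun _ => ε * p.2) + γ • fun x => translates unitBump d ((x - a) / w₁) := by
    ext x
    simp [gridCdf, bumpGrid_eq, hd]
  rw [dirDiff_fst, hdec, fwdDiff_iter_add, fwdDiff_iter_constant hr, zero_add,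
    fwdDiff_iter_const_smul, Pi.smul_apply, fwdDiff_iter_comp_affine, smul_eq_mul, abs_mul,
    abs_of_nonneg hγ]
  have h1 := hC m₁ d (fun j => abs_translates_unitBump_le (fun _ => abs_bitValue_le _) _) (h / w₁)
    ((p.1 - a) / w₁)
  rw [abs_div, abs_of_pos hw₁, Real.div_rpow (abs_nonneg _) hw₁.le] at h1
  calc _ ≤ γ * (C * (|h| ^ β / w₁ ^ β)) := by gcongr
    _ = _ := by ring

/-- Order at least `2` removes the linear part; rescaling the bumps to width `w₂` produces the
factor `w₂ ^ (-β)`. -/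
theorem dirDiff_snd_gridCdf_le {β C : ℝ} {r : ℕ} (hr : 2 ≤ r)
    (hC : ∀ (m : ℕ) (c : Fin m → ℝ), (∀ j, |c j| ≤ 1) → ∀ s u,
      |(fwdDiff s)^[r] (translates unitBump c) u| ≤ C * |s| ^ β)
    (hγ : 0 ≤ γ) (hw₂ : 0 < w₂) (θ : Fin m₁ × Fin m₂ → Bool) (h : ℝ) (p : ℝ × ℝ) :
    |dirDiff r h (0, 1) (fun p => gridCdf ε γ a c w₁ w₂ θ p.1 p.2) p| ≤
      γ * C / w₂ ^ β * |h| ^ β := by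
  set d : Fin m₂ → ℝ := fun k => translates unitBump (fun j => bitValue (θ (j, k)))
    ((p.1 - a) / w₁) with hd
  have hdec : (fun y => gridCdf ε γ a c w₁ w₂ θ p.1 y) =
      (fun y => ε * y) + γ • fun y => translates unitBump d ((y - c) / w₂) := by
    ext y
    simp [gridCdf, bumpGrid, hd]
  rw [dirDiff_snd, hdec, fwdDiff_iter_add, fwdDiff_iter_linear hr, zero_add,
    fwdDiff_iter_const_smul, Pi.smul_apply, fwdDiff_iter_comp_affine, smul_eq_mul, abs_mul,
    abs_of_nonneg hγ]
  have h1 := hC m₂ d (fun j => abs_translates_unitBump_le (fun _ => abs_bitValue_le _) _) (h / w₂)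
    ((p.2 - c) / w₂)
  rw [abs_div, abs_of_pos hw₂, Real.div_rpow (abs_nonneg _) hw₂.le] at h1
  calc _ ≤ γ * (C * (|h| ^ β / w₂ ^ β)) := by gcongr
    _ = _ := by ring

theorem abs_gridCdf_flipAt_sub (hγ : 0 ≤ γ) (θ : Fin m₁ × Fin m₂ → Bool) (i : Fin m₁ × Fin m₂)
    (x y : ℝ) :
    |gridCdf ε γ a c w₁ w₂ (flipAt i θ) x y - gridCdf ε γ a c w₁ w₂ θ x y| =
      γ * (unitBump ((x - a) / w₁ - (i.1 : ℕ)) * unitBump ((y - c) / w₂ - (i.2 : ℕ))) := by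
  rw [← abs_bumpGrid_flipAt_sub θ, gridCdf, gridCdf, add_sub_add_left_eq_sub, ← mul_sub, abs_mul,
    abs_of_nonneg hγ]

theorem minimaxRisk_ge_of_grid {a₂ β₁ β₂ L C₁ C₂ D : ℝ} {h₁ : ℝ≥0} (hm₁ : 0 < m₁) (hm₂ : 0 < m₂)
    (hw₁ : 0 < w₁) (hw₂ : 0 < w₂) (ha₂ : 0 ≤ a₂) (hac : a₂ < c) (hb : c + m₂ * w₂ = b)
    (hβ₁ : 0 < β₁) (hβ₂ : 1 < β₂) (hC₁0 : 0 ≤ C₁) (hC₂0 : 0 ≤ C₂)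
    (hC₁ : ∀ (m : ℕ) (c : Fin m → ℝ), (∀ j, |c j| ≤ 1) → ∀ s u,
      |(fwdDiff s)^[⌊β₁⌋₊ + 1] (translates unitBump c) u| ≤ C₁ * |s| ^ β₁)
    (hC₂ : ∀ (m : ℕ) (c : Fin m → ℝ), (∀ j, |c j| ≤ 1) → ∀ s u,
      |(fwdDiff s)^[⌊β₂⌋₊ + 1] (translates unitBump c) u| ≤ C₂ * |s| ^ β₂)
    (hD : ∀ (θ : Fin m₁ × Fin m₂ → Bool) (u v : ℝ), |bumpGridDeriv θ u v| ≤ D)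
    (hε : 0 < ε) (hγ : 0 ≤ γ) (hmono : γ / w₂ * D ≤ ε) (hhalf : ε * b + γ ≤ 1 / 2)
    (hL : volume (rect a (a + m₁ * w₁) a₂ b) ^ (2 : ℝ)⁻¹ *
      ENNReal.ofReal (γ * C₁ / w₁ ^ β₁ + γ * C₂ / w₂ ^ β₂ + (ε * b + γ)) ≤ ENNReal.ofReal L)
    {f : ℝ × ℝ → ℝ≥0∞} (hf1 : ∫⁻ p, f p = 1)
    (hfh : ∀ᵐ p ∂(volume.restrict (rect a (a + m₁ * w₁) a₂ b)), f p ≤ h₁) {n : ℕ}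
    (hinfo : (1 + 2 * γ ^ 2 / (ε * c) * (h₁ * (w₁ * w₂))) ^ n ≤ 2) :
    ENNReal.ofReal (γ ^ 2 * ((m₁ * w₁) * (m₂ * w₂)) / 32) ≤
      minimaxRisk (rect a (a + m₁ * w₁) a₂ b) β₁ β₂ L n (volume.withDensity f) := by
  have hm₁' : (0 : ℝ) < m₁ := by exact_mod_cast hm₁
  have hm₂' : (0 : ℝ) < m₂ := by exact_mod_cast hm₂
  have hc : 0 < c := ha₂.trans_lt hac
  have hcb : c < b := by rw [← hb]; linarith [mul_pos hm₂' hw₂]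
  have hb0 : 0 ≤ b := (hc.trans hcb).le
  have hεb : ε * b ≤ 1 := by linarith
  set A := rect a (a + m₁ * w₁) a₂ b with hA
  have hAm : MeasurableSet A := measurableSet_rect _ _ _ _
  have hAfin : volume A ≠ ⊤ := by
    rw [hA, volume_rect]; exact ENNReal.mul_ne_top ENNReal.ofReal_ne_top ENNReal.ofReal_ne_top
  have hAconv : Convex ℝ A := (convex_Icc _ _).prod (convex_Icc _ _)
  have hν : IsProbabilityMeasure (volume.withDensity f) :=
    ⟨by rw [withDensity_apply _ MeasurableSet.univ, Measure.restrict_univ, hf1]⟩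
  set κ : (Fin m₁ × Fin m₂ → Bool) → Kernel ℝ ℝ := gridLifetime ε γ a c w₁ w₂ b with hκ
  have hcdf (θ : Fin m₁ × Fin m₂ → Bool) (p : ℝ × ℝ) : condCdf (κ θ) p =
      gridCdf ε γ a c w₁ w₂ θ p.1 (max 0 (min p.2 b)) +
        if b + 1 ≤ p.2 then 1 - ε * b else 0 :=
    condCdf_lifetimeKernel (continuous_gridPdf θ)
      (gridPdf_nonneg hw₂ hγ θ (hD θ) hmono) (hasDerivAt_gridCdf θ) (gridCdf_zero hw₂ hc.le θ) hb0
      (gridCdf_right hw₂ hb θ) (by positivity) hεb p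
  have hMK (θ : Fin m₁ × Fin m₂ → Bool) : IsMarkovKernel (κ θ) :=
    lifetimeKernel_isMarkov (continuous_gridPdf θ)
      (gridPdf_nonneg hw₂ hγ θ (hD θ) hmono) (hasDerivAt_gridCdf θ) (gridCdf_zero hw₂ hc.le θ) hb0
      (gridCdf_right hw₂ hb θ) (by positivity) hεb
  have hcdfA (θ : Fin m₁ × Fin m₂ → Bool) (p : ℝ × ℝ) (h0 : 0 ≤ p.2) (h1 : p.2 ≤ b) :
      condCdf (κ θ) p = gridCdf ε γ a c w₁ w₂ θ p.1 p.2 := by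
    rw [hcdf, if_neg (by linarith), add_zero, min_eq_left h1, max_eq_right h0]
  have hdiff (θ : Fin m₁ × Fin m₂ → Bool) (i : Fin m₁ × Fin m₂) (p : ℝ × ℝ) :
      |condCdf (κ (flipAt i θ)) p - condCdf (κ θ) p| =
        γ * (unitBump ((p.1 - a) / w₁ - (i.1 : ℕ)) *
          unitBump ((max 0 (min p.2 b) - c) / w₂ - (i.2 : ℕ))) := by
    rw [hcdf, hcdf, add_sub_add_right_eq_sub, abs_gridCdf_flipAt_sub hγ]
  have hval (θ : Fin m₁ × Fin m₂ → Bool) (x y : ℝ) :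
      ε * y ≤ gridCdf ε γ a c w₁ w₂ θ x y ∧ gridCdf ε γ a c w₁ w₂ θ x y ≤ ε * y + γ := by
    have h1 := bumpGrid_nonneg θ ((x - a) / w₁) ((y - c) / w₂)
    have h2 := (abs_le.1 (abs_bumpGrid_le θ ((x - a) / w₁) ((y - c) / w₂))).2
    rw [gridCdf]
    constructor <;> nlinarith
  have hclass (θ : Fin m₁ × Fin m₂ → Bool) : κ θ ∈ lifetimeClass A β₁ β₂ L := by
    refine ⟨hMK θ, fun x => lifetimeKernel_Iic_zero (continuous_gridPdf θ) hb0 x, ?_⟩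
    have hEq : ∀ p ∈ A, condCdf (κ θ) p = gridCdf ε γ a c w₁ w₂ θ p.1 p.2 := fun p hp =>
      hcdfA θ p (ha₂.trans hp.2.1) hp.2.2
    have := hMK θ
    refine mem_besovBall_of_bounds hAm hAfin hβ₁ (zero_lt_one.trans hβ₂) measurable_condCdf
      (by positivity) (by positivity) (by positivity) (fun h p hp => ?_) (fun h p hp => ?_)
      (fun p hp => ?_) hL
    · rw [dirDiff_congr hAconv hEq hp]
      exact dirDiff_fst_gridCdf_le (Nat.le_add_left 1 _) hC₁ hγ hw₁ θ h p
    · rw [dirDiff_congr hAconv hEq hp]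
      have : 1 ≤ ⌊β₂⌋₊ := Nat.le_floor (by exact_mod_cast hβ₂.le)
      exact dirDiff_snd_gridCdf_le (by omega) hC₂ hγ hw₂ θ h p
    · rw [abs_of_nonneg (condCdf_nonneg p), hEq p hp]
      refine (hval θ _ _).2.trans ?_
      have : ε * p.2 ≤ ε * b := by gcongr; exact hp.2.2
      linarith
  have hcell (s t : ℝ) (hs : 0 ≤ s) (ht : t ≤ 1) (i : Fin m₁ × Fin m₂) :
      gridCell a c w₁ w₂ s t i ⊆ rect a (a + m₁ * w₁) c b := by
    rw [← hb]; exact gridCell_subset hw₁ hw₂ hs ht i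
  have hcellA : rect a (a + m₁ * w₁) c b ⊆ A :=
    Set.prod_mono subset_rfl (Set.Icc_subset_Icc_left hac.le)
  refine le_trans (le_of_eq ?_) (minimaxRisk_ge_of_hypercube κ hclass
    (C := gridCell a c w₁ w₂ 0 1) (I := gridCell a c w₁ w₂ (1 / 4) (3 / 4))
    (γ := γ) (η := ε * c) (v := ENNReal.ofReal (w₁ * (3 / 4 - 1 / 4)) *
      ENNReal.ofReal (w₂ * (3 / 4 - 1 / 4)))
    (fun i => measurableSet_rect _ _ _ _) (fun i => measurableSet_rect _ _ _ _)
    (fun i => (hcell _ _ (by norm_num) (by norm_num) i).trans hcellA)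
    (pairwise_disjoint_gridCell hw₁ hw₂ (by norm_num) (by norm_num)) (by positivity)
    (fun θ i p hp => ?_) (fun θ i p hp => ?_) (fun θ i p hp => ?_)
    (fun i => volume_gridCell _ _ i)
    (ENNReal.mul_ne_top ENNReal.ofReal_ne_top ENNReal.ofReal_ne_top) (fun i => ?_))
  -- The `32` collects `1/2` from the squared loss, `1/4` from the area of the inner cell, and a
  -- `1/2` each from the two-point bound and the averaging.
  · rw [Fintype.card_prod, Fintype.card_fin, Fintype.card_fin,
      ← ENNReal.ofReal_mul (by positivity), ← ENNReal.ofReal_mul (by positivity),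
      ← ENNReal.ofReal_natCast, ← ENNReal.ofReal_ofNat 2, ← ENNReal.ofReal_div_of_pos two_pos,
      ← ENNReal.ofReal_mul (by positivity), ← ENNReal.ofReal_div_of_pos two_pos]
    congr 1
    push_cast
    ring
  -- If both bumps were nonzero, the clamped ordinate would lie strictly between `0` and `b`;
  -- clamping would then be inactive and `p` itself would be in the cell.
  · rw [← sub_eq_zero, ← abs_eq_zero, hdiff]
    by_cases h1 : (p.1 - a) / w₁ - (i.1 : ℕ) ∈ Set.Ioo (0 : ℝ) 1
    · rw [unitBump_eq_zero (u := _ / w₂ - _), mul_zero, mul_zero]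
      intro h2
      apply hp
      have h3 : (p.1, max 0 (min p.2 b)) ∈ gridCell a c w₁ w₂ 0 1 i :=
        (mem_gridCell hw₁ hw₂).2 ⟨Set.Ioo_subset_Icc_self h1, Set.Ioo_subset_Icc_self h2⟩
      have hlow : 0 < max 0 (min p.2 b) := by
        have := (hcell 0 1 le_rfl le_rfl i h3).2.1
        exact hc.trans_le this
      have hup : max 0 (min p.2 b) < b := by
        have h4 : ((i.2 : ℕ) : ℝ) + 1 ≤ m₂ := by exact_mod_cast i.2.2
        have h5 : (max 0 (min p.2 b) - c) / w₂ < m₂ := by linarith [h2.2]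
        rw [div_lt_iff₀ hw₂] at h5
        linarith
      have h6 : max 0 (min p.2 b) = p.2 := by
        rcases le_total p.2 b with h | h
        · rw [min_eq_left h] at hlow ⊢
          rcases le_total 0 p.2 with h' | h'
          · exact max_eq_right h'
          · rw [max_eq_left h'] at hlow; exact absurd hlow (lt_irrefl _)
        · rw [min_eq_right h, max_eq_right hb0] at hup; exact absurd hup (lt_irrefl _)
      rw [h6] at h3
      exact h3
    · rw [unitBump_eq_zero h1, zero_mul, mul_zero]
  · have hp' := hcell 0 1 le_rfl le_rfl i hp
    rw [hdiff, hcdfA θ p (hc.le.trans hp'.2.1) hp'.2.2]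
    refine ⟨?_, ?_, ?_⟩
    · refine le_trans ?_ (hval θ _ _).1
      gcongr
      exact hp'.2.1
    · refine (hval θ _ _).2.trans ?_
      have : ε * p.2 ≤ ε * b := by gcongr; exact hp'.2.2
      linarith
    · exact mul_le_of_le_one_right hγ (mul_le_one₀ unitBump.le_one unitBump.nonneg unitBump.le_one)
  · have hp' := hcell _ _ (by norm_num) (by norm_num) i hp
    have h2 := (mem_gridCell hw₁ hw₂).1 hp
    rw [hdiff, min_eq_left hp'.2.2, max_eq_right (hc.le.trans hp'.2.1), unitBump_eq_one h2.1,
      unitBump_eq_one h2.2, mul_one, mul_one]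
  · have hCm : MeasurableSet (gridCell a c w₁ w₂ 0 1 i) := measurableSet_rect _ _ _ _
    have hνC : (volume.withDensity f) (gridCell a c w₁ w₂ 0 1 i) ≤
        ENNReal.ofReal (h₁ * (w₁ * w₂)) := by
      rw [withDensity_apply _ hCm]
      have hae : ∀ᵐ p ∂(volume.restrict (gridCell a c w₁ w₂ 0 1 i)), f p ≤ h₁ :=
        ae_restrict_of_ae_restrict_of_subset ((hcell 0 1 le_rfl le_rfl i).trans hcellA) hfh
      refine (lintegral_mono_ae hae).trans_eq ?_
      rw [setLIntegral_const, volume_gridCell, sub_zero, mul_one, mul_one,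
        ← ENNReal.ofReal_mul hw₁.le, ENNReal.ofReal_mul (NNReal.coe_nonneg h₁),
        ENNReal.ofReal_coe_nnreal]
    calc _ ≤ (1 + ENNReal.ofReal (2 * γ ^ 2 / (ε * c)) * ENNReal.ofReal (h₁ * (w₁ * w₂))) ^ n := by
          gcongr
      _ = ENNReal.ofReal ((1 + 2 * γ ^ 2 / (ε * c) * (h₁ * (w₁ * w₂))) ^ n) := by
          rw [← ENNReal.ofReal_mul (by positivity), ← ENNReal.ofReal_one,
            ← ENNReal.ofReal_add zero_le_one (by positivity), ENNReal.ofReal_pow (by positivity)]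
      _ ≤ ENNReal.ofReal 2 := ENNReal.ofReal_le_ofReal hinfo
      _ = 2 := by simp

end Grid

/-! ### Choice of the parameters -/

/-- Finitely many smallness constraints, each linear in the constant, can be met together by
intersecting such events. -/
theorem eventually_mul_le (K : ℝ) {b : ℝ} (hb : 0 < b) :
    ∀ᶠ c : ℝ in nhdsWithin 0 (Set.Ioi 0), c * K ≤ b := by
  have h : Filter.Tendsto (fun c : ℝ => c * K) (nhdsWithin 0 (Set.Ioi 0)) (nhds 0) := by
    have : Continuous fun c : ℝ => c * K := continuous_id.mul continuous_const
    have h0 := this.tendsto 0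
    rw [zero_mul] at h0
    exact h0.mono_left nhdsWithin_le_nhds
  exact (h.eventually_lt_const hb).mono fun _ h => h.le

theorem one_add_pow_le_two {x : ℝ} (hx : 0 ≤ x) (n : ℕ) (h : n * x ≤ 1 / 2) :
    (1 + x) ^ n ≤ 2 := by
  calc (1 + x) ^ n ≤ Real.exp x ^ n := by
        gcongr
        linarith [Real.add_one_le_exp x]
    _ = Real.exp (n * x) := (Real.exp_nat_mul x n).symm
    _ ≤ Real.exp (Real.log 2) := Real.exp_le_exp.2 (by linarith [Real.log_two_gt_d9])
    _ = 2 := Real.exp_log two_pos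

/-- The number of cells of the grid associated with the bandwidth `h`. -/
theorem exists_grid_size {h β : ℝ} (hh : 0 < h) (hh1 : h ≤ 1) (hβ : 0 < β) :
    ∃ m : ℕ, 0 < m ∧ h ^ (-(1 / β)) ≤ m ∧ (m : ℝ) ≤ 2 * h ^ (-(1 / β)) := by
  have h1 : 1 ≤ h ^ (-(1 / β)) :=
    Real.one_le_rpow_of_pos_of_le_one_of_nonpos hh hh1 (neg_nonpos.2 (by positivity))
  refine ⟨⌈h ^ (-(1 / β))⌉₊, Nat.ceil_pos.2 (by linarith), Nat.le_ceil _, ?_⟩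
  have := Nat.ceil_lt_add_one (zero_le_one.trans h1)
  linarith

theorem bandwidth_div_rpow_le {h β ℓ : ℝ} {m : ℕ} (hh : 0 < h) (hβ : 0 < β) (hℓ : 0 < ℓ)
    (hm0 : 0 < m) (hm : (m : ℝ) ≤ 2 * h ^ (-(1 / β))) : h / (ℓ / m) ^ β ≤ (2 / ℓ) ^ β := by
  have hm' : (0 : ℝ) < m := by exact_mod_cast hm0
  have hw : 0 < (ℓ / m) := by positivity
  rw [div_le_iff₀ (Real.rpow_pos_of_pos hw β), ← Real.mul_rpow (by positivity) hw.le]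
  have h1 : h ^ (1 / β) ≤ 2 / ℓ * (ℓ / m) := by
    have h2 : 2 / ℓ * (ℓ / m) = 2 / m := by field_simp
    rw [h2, le_div_iff₀ hm']
    calc h ^ (1 / β) * m ≤ h ^ (1 / β) * (2 * h ^ (-(1 / β))) := by gcongr
      _ = 2 * (h ^ (1 / β) * h ^ (-(1 / β))) := by ring
      _ = 2 := by rw [← Real.rpow_add hh]; simp
  calc h = (h ^ (1 / β)) ^ β := by
        rw [← Real.rpow_mul hh.le, one_div_mul_cancel hβ.ne', Real.rpow_one]
    _ ≤ _ := by gcongr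

end CurrentStatus

open CurrentStatus in
theorem theorem3 (a₁ b₁ a₂ b₂ : ℝ) (hA₁ : a₁ < b₁) (ha₂ : 0 ≤ a₂) (hA₂ : a₂ < b₂)
    (β₁ β₂ : ℝ) (hβ₁ : 0 < β₁) (hβ₂ : 1 < β₂) (L : ℝ) (hL : 0 < L) (h₁ : ℝ≥0) :
    ∃ c : ℝ, 0 < c ∧
      ∀ f : ℝ × ℝ → ℝ≥0∞, Measurable f → ∫⁻ p, f p = 1 →
        (∀ᵐ p ∂(volume.restrict (CurrentStatus.rect a₁ b₁ a₂ b₂)), f p ≤ h₁) →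
        ∀ n : ℕ, 1 ≤ n →
          ENNReal.ofReal (c * (n : ℝ) ^
              (-(CurrentStatus.harmMean β₁ β₂ / (CurrentStatus.harmMean β₁ β₂ + 1)))) ≤
            CurrentStatus.minimaxRisk (CurrentStatus.rect a₁ b₁ a₂ b₂) β₁ β₂ L n
              (volume.withDensity f) := by
  have hβ₂0 : 0 < β₂ := zero_lt_one.trans hβ₂
  have hb₂ : 0 < b₂ := ha₂.trans_lt hA₂
  obtain ⟨C₁, hC₁0, hC₁⟩ := exists_smoothness_constant hβ₁ (r := ⌊β₁⌋₊ + 1)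
    (by exact_mod_cast (Nat.lt_floor_add_one β₁).le)
  obtain ⟨C₂, hC₂0, hC₂⟩ := exists_smoothness_constant hβ₂0 (r := ⌊β₂⌋₊ + 1)
    (by exact_mod_cast (Nat.lt_floor_add_one β₂).le)
  obtain ⟨D, hD0, hD⟩ := exists_bound_bumpGridDeriv
  -- Starting the grid at `c > a₂` keeps `F ≥ ε c > 0` on the cells even when `a₂ = 0`.
  obtain ⟨c, hac, hcb⟩ := exists_between hA₂
  have hc : 0 < c := ha₂.trans_lt hac
  set ℓ₁ := b₁ - a₁ with hℓ₁
  set ℓ₂ := b₂ - c with hℓ₂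
  have hℓ₁0 : 0 < ℓ₁ := sub_pos.2 hA₁
  have hℓ₂0 : 0 < ℓ₂ := sub_pos.2 hcb
  set A := rect a₁ b₁ a₂ b₂ with hA
  set V := (volume A ^ (2 : ℝ)⁻¹).toReal with hV
  have hVeq : volume A ^ (2 : ℝ)⁻¹ = ENNReal.ofReal V := by
    rw [hV, ENNReal.ofReal_toReal]
    refine ENNReal.rpow_ne_top_of_nonneg (by norm_num) ?_
    rw [hA, volume_rect]
    exact ENNReal.mul_ne_top ENNReal.ofReal_ne_top ENNReal.ofReal_ne_top
  have hV0 : 0 ≤ V := ENNReal.toReal_nonneg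
  obtain ⟨ε, hε, hε1, hε2⟩ : ∃ ε : ℝ, 0 < ε ∧ ε * b₂ ≤ 1 / 4 ∧ ε * (V * b₂) ≤ L / 2 := by
    have h := (eventually_mul_le b₂ (b := 1 / 4) (by norm_num)).and
      (eventually_mul_le (V * b₂) (half_pos hL))
    obtain ⟨ε, h1, h2⟩ := (h.and self_mem_nhdsWithin).exists
    exact ⟨ε, h2, h1.1, h1.2⟩
  set E₁ := (2 / ℓ₁) ^ β₁ with hE₁
  set E₂ := (2 / ℓ₂) ^ β₂ with hE₂
  -- The four constraints ensure, in order, values at most `1/2`, monotonicity in `y`, the half of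
  -- the radius `L` left by the linear part, and the information bound.
  obtain ⟨c₀, hc₀, hc₀1, hc₀D, hc₀L, hc₀I⟩ : ∃ c₀ : ℝ, 0 < c₀ ∧ c₀ * 1 ≤ 1 / 4 ∧
      c₀ * (2 / ℓ₂ * D) ≤ ε ∧ c₀ * (V * (E₁ * C₁ + E₂ * C₂ + 1)) ≤ L / 2 ∧
      c₀ * (2 / (ε * c) * (h₁ * (ℓ₁ * ℓ₂))) ≤ 1 / 2 := by
    have h := (((eventually_mul_le 1 (b := 1 / 4) (by norm_num)).and
      (eventually_mul_le (2 / ℓ₂ * D) hε)).and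
      (eventually_mul_le (V * (E₁ * C₁ + E₂ * C₂ + 1)) (half_pos hL))).and
      (eventually_mul_le (2 / (ε * c) * (h₁ * (ℓ₁ * ℓ₂))) (b := 1 / 2) (by norm_num))
    obtain ⟨ε, h1, h2⟩ := (h.and self_mem_nhdsWithin).exists
    exact ⟨ε, h2, h1.1.1.1, h1.1.1.2, h1.1.2, h1.2⟩
  refine ⟨c₀ ^ 2 * (ℓ₁ * ℓ₂) / 32, by positivity, fun f _ hf1 hfh n hn => ?_⟩
  have hn0 : (0 : ℝ) < n := by exact_mod_cast hn
  have hn1 : (1 : ℝ) ≤ n := by exact_mod_cast hn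
  -- This exponent balances the information: `h ^ q` is the squared amplitude times the cell area,
  -- up to constants, and `n * h ^ q = 1`.
  set q : ℝ := 2 + 1 / β₁ + 1 / β₂ with hq
  have hq0 : 0 < q := by positivity
  set h : ℝ := (n : ℝ) ^ (-(1 / q)) with hh
  have hh0 : 0 < h := Real.rpow_pos_of_pos hn0 _
  have hh1 : h ≤ 1 := Real.rpow_le_one_of_one_le_of_nonpos hn1 (neg_nonpos.2 (by positivity))
  obtain ⟨m₁, hm₁, hm₁l, hm₁u⟩ := exists_grid_size hh0 hh1 hβ₁
  obtain ⟨m₂, hm₂, hm₂l, hm₂u⟩ := exists_grid_size hh0 hh1 hβ₂0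
  have hm₁' : (0 : ℝ) < m₁ := by exact_mod_cast hm₁
  have hm₂' : (0 : ℝ) < m₂ := by exact_mod_cast hm₂
  have hmw₁ : m₁ * (ℓ₁ / m₁) = ℓ₁ := mul_div_cancel₀ _ hm₁'.ne'
  have hmw₂ : m₂ * (ℓ₂ / m₂) = ℓ₂ := mul_div_cancel₀ _ hm₂'.ne'
  have hrect : rect a₁ (a₁ + m₁ * (ℓ₁ / m₁)) a₂ b₂ = A := by rw [hmw₁, hℓ₁, hA]; congr 1; ring
  have hw₂ : h / (ℓ₂ / m₂) ≤ 2 / ℓ₂ := by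
    have e : h / (ℓ₂ / m₂) = h * m₂ / ℓ₂ := by field_simp
    rw [e]
    gcongr
    have h2 : h ≤ h ^ (1 / β₂) := by
      conv_lhs => rw [← Real.rpow_one h]
      exact Real.rpow_le_rpow_of_exponent_ge hh0 hh1 ((div_le_one hβ₂0).2 hβ₂.le)
    calc h * m₂ ≤ h ^ (1 / β₂) * (2 * h ^ (-(1 / β₂))) := by gcongr
      _ = 2 * (h ^ (1 / β₂) * h ^ (-(1 / β₂))) := by ring
      _ = 2 := by rw [← Real.rpow_add hh0]; simp
  have hγ : c₀ * h ≤ c₀ := mul_le_of_le_one_right hc₀.le hh1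
  have hhq : n * h ^ q = 1 := by
    rw [hh, ← Real.rpow_mul hn0.le, neg_mul, one_div_mul_cancel hq0.ne', Real.rpow_neg_one,
      mul_inv_cancel₀ hn0.ne']
  have harea : h ^ 2 * (ℓ₁ / m₁ * (ℓ₂ / m₂)) ≤ ℓ₁ * ℓ₂ * h ^ q := by
    have key {β : ℝ} {m : ℕ} (hm : 0 < (m : ℝ)) (hml : h ^ (-(1 / β)) ≤ m) :
        1 / (m : ℝ) ≤ h ^ (1 / β) := by
      rw [div_le_iff₀ hm]
      calc (1 : ℝ) = h ^ (1 / β) * h ^ (-(1 / β)) := by rw [← Real.rpow_add hh0]; simp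
        _ ≤ _ := by gcongr
    calc h ^ 2 * (ℓ₁ / m₁ * (ℓ₂ / m₂)) = ℓ₁ * ℓ₂ * (h ^ 2 * (1 / m₁) * (1 / m₂)) := by ring
      _ ≤ ℓ₁ * ℓ₂ * (h ^ 2 * h ^ (1 / β₁) * h ^ (1 / β₂)) := by
          gcongr
          · exact key hm₁' hm₁l
          · exact key hm₂' hm₂l
      _ = _ := by
          rw [hq, Real.rpow_add hh0, Real.rpow_add hh0, Real.rpow_two]
  have hmain := minimaxRisk_ge_of_grid (ε := ε) (γ := c₀ * h) (a := a₁) (c := c)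
    (w₁ := ℓ₁ / m₁) (w₂ := ℓ₂ / m₂) (b := b₂) (a₂ := a₂) (L := L) (C₁ := C₁) (C₂ := C₂)
    (D := D) (h₁ := h₁) (f := f) (n := n) hm₁ hm₂ (by positivity) (by positivity) ha₂ hac
    (by rw [hmw₂, hℓ₂]; ring) hβ₁ hβ₂ hC₁0 hC₂0 hC₁ hC₂ (hD m₁ m₂) hε (by positivity) ?_ ?_ ?_
    hf1 ?_ ?_
  · rw [hrect, hmw₁, hmw₂] at hmain
    refine le_trans (le_of_eq ?_) hmain
    congr 1
    -- With `B` the harmonic mean, `1/β₁ + 1/β₂ = 2 / B`, hence `2 / q = B / (B + 1)`.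
    have hexp : (n : ℝ) ^ (-(harmMean β₁ β₂ / (harmMean β₁ β₂ + 1))) = h ^ 2 := by
      rw [hh, ← Real.rpow_two, ← Real.rpow_mul hn0.le]
      congr 1
      rw [hq, harmMean]
      field_simp
      ring
    rw [hexp]
    ring
  · calc c₀ * h / (ℓ₂ / m₂) * D = c₀ * (h / (ℓ₂ / m₂) * D) := by ring
      _ ≤ c₀ * (2 / ℓ₂ * D) := by gcongr
      _ ≤ ε := hc₀D
  · linarith
  · rw [hrect, hVeq, ← ENNReal.ofReal_mul hV0]
    apply ENNReal.ofReal_le_ofReal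
    have hr₁ := bandwidth_div_rpow_le hh0 hβ₁ hℓ₁0 hm₁ hm₁u
    have hr₂ := bandwidth_div_rpow_le hh0 hβ₂0 hℓ₂0 hm₂ hm₂u
    calc V * (c₀ * h * C₁ / (ℓ₁ / m₁) ^ β₁ + c₀ * h * C₂ / (ℓ₂ / m₂) ^ β₂ + (ε * b₂ + c₀ * h))
        = c₀ * (V * (h / (ℓ₁ / m₁) ^ β₁ * C₁ + h / (ℓ₂ / m₂) ^ β₂ * C₂ + h)) +
          ε * (V * b₂) := by ring
      _ ≤ c₀ * (V * (E₁ * C₁ + E₂ * C₂ + 1)) + ε * (V * b₂) := by gcongr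
      _ ≤ L := by linarith
  · rwa [hrect]
  · refine one_add_pow_le_two (by positivity) n ?_
    calc n * (2 * (c₀ * h) ^ 2 / (ε * c) * (h₁ * (ℓ₁ / m₁ * (ℓ₂ / m₂))))
        = n * (c₀ * c₀) * (2 / (ε * c) * h₁) * (h ^ 2 * (ℓ₁ / m₁ * (ℓ₂ / m₂))) := by ring
      -- One factor `c₀` is bounded by `1`, reducing the quadratic constraint to the linear one
      -- chosen above.
      _ ≤ n * (c₀ * 1) * (2 / (ε * c) * h₁) * (ℓ₁ * ℓ₂ * h ^ q) := by
          gcongr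
          linarith
      _ = c₀ * (2 / (ε * c) * (h₁ * (ℓ₁ * ℓ₂))) * (n * h ^ q) := by ring
      _ ≤ 1 / 2 := by rw [hhq, mul_one]; exact hc₀I
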